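/- Let $n \ge 3$ and $\ell \ge 0$ be integers, let $S_{n-1} \subset \mathbb{R}^n$ be the unit sphere, and for $f : S_{n-1} \to \mathbb{C}$ write $\|f\|^2 = \mathbb{E}_x |f(x)|^2$, where $x$ is uniform on $S_{n-1}$ (normalized surface measure). A \emph{spherical harmonic of degree $\ell$} is the restriction to $S_{n-1}$ of a homogeneous polynomial $p$ of degree $\ell$ with complex coefficients (possibly $p=0$) such that $\sum_i \partial^2 p/\partial x_i^2 = 0$; let $d_\ell$ be the dimension of the space of these functions. Let $\alpha = n/2 - 1$ and $$G_\ell(z) = \sum_{j=0}^{\lfloor \ell/2 \rfloor} (-1)^j \frac{\Gamma(\ell-j+\alpha)}{\Gamma(\alpha)\, j!\, (\ell-2j)!} (2z)^{\ell-2j}, \qquad \gamma_\ell(z) = \frac{G_\ell(z)}{\sqrt{N_\ell}}, \qquad N_\ell = \mathbb{E}_{x}\, G_\ell(\eta\cdot x)^2 ,$$ where $\eta = (1,0,\dots,0)$ and $x$ is uniform on $S_{n-1}$; so $\gamma_\ell$ is the Gegenbauer polynomial normalized as a zonal function on the sphere. For integers $0 \le m, h \le n$ let $$\kappa_m(h)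 = \sum_{j=0}^{m} (-1)^j \binom{m}{j} \binom{n-m}{h-j}$$ be the Kravchuk polynomial, where $\binom{n-m}{h-j} = 0$ if $j > h$. Identify $\mathbb{Z}_2^n$ with $H = \{\pm 1/\sqrt n\}^n \subset S_{n-1}$ by $z \mapsto ((-1)^{z_i}/\sqrt n)_i$. For $k \in \mathbb{Z}_2^n$ let $|k|$ be its Hamming weight and $\chi_k(x) = \prod_{i : k_i = 1} \sqrt n\, x_i$. For $g : S_{n-1} \to \mathbb{C}$ let $\widehat{g}|_H(k) = 2^{-n}\sum_{x \in H} \overline{g(x)}\, \chi_k(x)$; the energy of $g|_H$ at $k$ is $|\widehat{g}|_H(k)|^2$. Let $f : S_{n-1} \to \mathbb{C}$ be a spherical harmonic of degree $\ell$, let $R$ be distributed according to the Haar probability measure on $\mathrm{SO}_n$, and let $(Rf)(x) = f(R^{-1}x)$. Then for every $k \in \mathbb{Z}_2^n$ the energy $|\widehat{Rf}|_H(k)|^2$ is an integrable function of $R$, and $$\mathbb{E}_R \left| \widehat{Rf}|_H(k) \right|^2 = \frac{\|f\|^2}{\sqrt{d_\ell}}\, \frac{1}{2^n} \sum_{h=0}^{n}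 \kappa_{|k|}(h)\, \gamma_\ell\!\left(1 - \frac{2h}{n}\right).$$ -/

import Mathlib

open MeasureTheory

namespace SphereCube

noncomputable section

/-- The unit sphere of Euclidean space `ℝⁿ`. -/
abbrev Sph (n : ℕ) : Type := Metric.sphere (0 : EuclideanSpace ℝ (Fin n)) 1

/-- The rotation group `SO_n`. -/
abbrev SO (n : ℕ) : Type := Matrix.specialOrthogonalGroup (Fin n) ℝ

/-! ### The group `SO_n` is a compact topological group, and its Haar probability measure -/

lemma SO_mul_transpose {n : ℕ} (R : SO n) : R.1 * R.1.transpose = 1 :=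
  (Matrix.mem_orthogonalGroup_iff (Fin n) ℝ).1 (Matrix.mem_specialOrthogonalGroup_iff.1 R.2).1

lemma SO_transpose_mul {n : ℕ} (R : SO n) : R.1.transpose * R.1 = 1 :=
  (Matrix.mem_orthogonalGroup_iff' (Fin n) ℝ).1 (Matrix.mem_specialOrthogonalGroup_iff.1 R.2).1

lemma SO_inv_val {n : ℕ} (R : SO n) : (R⁻¹).1 = R.1.transpose := rfl

instance instIsTopologicalGroupSO (n : ℕ) : IsTopologicalGroup (SO n) where
  continuous_mul := by fun_prop
  continuous_inv := by
    refine Continuous.subtype_mk (f := fun R : SO n => R.1.transpose) ?_ _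
    exact continuous_subtype_val.matrix_transpose

lemma SO_entry_mem {n : ℕ} (R : SO n) (i j : Fin n) : R.1 i j ∈ Set.Icc (-1 : ℝ) 1 := by
  have h : ∑ l, R.1 i l * R.1 i l = 1 := by
    have := congrFun (congrFun (SO_mul_transpose R) i) i
    simpa [Matrix.mul_apply] using this
  have h2 : R.1 i j * R.1 i j ≤ ∑ l, R.1 i l * R.1 i l :=
    Finset.single_le_sum (f := fun l => R.1 i l * R.1 i l)
      (fun l _ => mul_self_nonneg _) (Finset.mem_univ j)
  constructor <;> nlinarith

instance instCompactSpaceSO (n : ℕ) : CompactSpace (SO n) := by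
  refine isCompact_iff_compactSpace
    (s := ((Matrix.specialOrthogonalGroup (Fin n) ℝ : Submonoid _) :
      Set (Matrix (Fin n) (Fin n) ℝ))).1 ?_
  have hK : IsCompact (Set.univ.pi fun _ : Fin n => Set.univ.pi fun _ : Fin n =>
      Set.Icc (-1 : ℝ) 1) :=
    isCompact_univ_pi fun _ => isCompact_univ_pi fun _ => isCompact_Icc
  refine IsCompact.of_isClosed_subset (X := Matrix (Fin n) (Fin n) ℝ) hK ?_ ?_
  · have : ((Matrix.specialOrthogonalGroup (Fin n) ℝ : Submonoid _) :
        Set (Matrix (Fin n) (Fin n) ℝ)) = {A | A * A.transpose = 1} ∩ {A | A.det = 1} := by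
      ext A
      simp only [SetLike.mem_coe, Matrix.mem_specialOrthogonalGroup_iff,
        Matrix.mem_orthogonalGroup_iff, Set.mem_inter_iff, Set.mem_ofPred_eq]
    rw [this]
    exact (isClosed_eq (by fun_prop) continuous_const).inter
      (isClosed_eq (by fun_prop) continuous_const)
  · intro A hA i _ j _
    exact SO_entry_mem ⟨A, hA⟩ i j

instance instMeasurableSpaceSO (n : ℕ) : MeasurableSpace (SO n) := borel _

instance instBorelSpaceSO (n : ℕ) : BorelSpace (SO n) := ⟨rfl⟩

/-- The Haar measure on `SO_n`, normalized to total mass `1`. -/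
def haarSO (n : ℕ) : Measure (SO n) := Measure.haarMeasure ⊤

instance instIsProbabilityMeasureHaarSO (n : ℕ) : IsProbabilityMeasure (haarSO n) :=
  ⟨by simpa [haarSO] using
    Measure.haarMeasure_self (G := SO n) (K₀ := (⊤ : TopologicalSpace.PositiveCompacts (SO n)))⟩

instance instIsHaarMeasureHaarSO (n : ℕ) : (haarSO n).IsHaarMeasure :=
  inferInstanceAs (Measure.haarMeasure _).IsHaarMeasure

/-! ### Rotating points and functions -/

/-- The point `R x` of the sphere, for `R ∈ SO_n` and `x` on the sphere. -/
def rotPoint {n : ℕ} (R : SO n) (x : Sph n) : Sph n :=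
  ⟨WithLp.toLp 2 (R.1.mulVec x.1.ofLp), by
    have hx : ∑ i, x.1 i ^ 2 = 1 := by
      have := x.2
      rw [mem_sphere_zero_iff_norm, EuclideanSpace.norm_eq, Real.sqrt_eq_one] at this
      simpa using this
    have h1 : dotProduct (R.1.mulVec x.1.ofLp) (R.1.mulVec x.1.ofLp)
        = dotProduct x.1.ofLp x.1.ofLp := by
      rw [Matrix.dotProduct_mulVec, Matrix.vecMul_mulVec, SO_transpose_mul, Matrix.vecMul_one]
    rw [mem_sphere_zero_iff_norm, EuclideanSpace.norm_eq, Real.sqrt_eq_one]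
    simp only [dotProduct, ← pow_two] at h1
    simpa [h1] using hx⟩

/-- The rotated function `(R f)(x) = f (R⁻¹ x)`. -/
def rotFun {n : ℕ} (R : SO n) (f : Sph n → ℂ) : Sph n → ℂ := fun x => f (rotPoint R⁻¹ x)

/-! ### Spherical harmonics -/

/-- The Laplacian `∑ᵢ ∂²/∂xᵢ²` on complex polynomials in `n` variables. -/
def polyLaplacian (n : ℕ) : MvPolynomial (Fin n) ℂ →ₗ[ℂ] MvPolynomial (Fin n) ℂ :=
  ∑ i, (MvPolynomial.pderiv i).toLinearMap ∘ₗ (MvPolynomial.pderiv i).toLinearMap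

/-- The restriction of a polynomial to the unit sphere. -/
def restrictToSphere (n : ℕ) : MvPolynomial (Fin n) ℂ →ₗ[ℂ] (Sph n → ℂ) where
  toFun p := fun x => MvPolynomial.eval (fun i => ((x.1 i : ℝ) : ℂ)) p
  map_add' p q := by ext x; simp
  map_smul' c p := by ext x; simp [MvPolynomial.smul_eval]

/-- The space of spherical harmonics of degree `ℓ`: the restrictions to the sphere of the
homogeneous polynomials of degree `ℓ` that are harmonic. -/
def sphericalHarmonics (n ℓ : ℕ) : Submodule ℂ (Sph n → ℂ) :=
  (MvPolynomial.homogeneousSubmodule (Fin n) ℂ ℓ ⊓ LinearMap.ker (polyLaplacian n)).map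
    (restrictToSphere n)

/-- The dimension `d_ℓ` of the space of spherical harmonics of degree `ℓ`. -/
def harmDim (n ℓ : ℕ) : ℕ := Module.finrank ℂ (sphericalHarmonics n ℓ)

/-- `‖f‖² = 𝔼_x |f x|²` for `x` uniform on the sphere (normalized surface measure). -/
def sphereNormSq {n : ℕ} (f : Sph n → ℂ) : ℝ :=
  ⨍ x, ‖f x‖ ^ 2 ∂(volume : Measure (EuclideanSpace ℝ (Fin n))).toSphere

/-! ### Gegenbauer polynomials -/

/-- The classical Gegenbauer polynomial `G^{(ℓ)}(z)` with parameter `α = n/2 - 1`; the factorials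
`(ℓ-k+α-1)!` and `(α-1)!` are values of the Gamma function. -/
def gegenbauerG (n ℓ : ℕ) (z : ℝ) : ℝ :=
  ∑ k ∈ Finset.range (ℓ / 2 + 1),
    (-1) ^ k * Real.Gamma ((ℓ : ℝ) - k + ((n : ℝ) / 2 - 1)) /
      (Real.Gamma ((n : ℝ) / 2 - 1) * (k.factorial : ℝ) * ((ℓ - 2 * k).factorial : ℝ)) *
      (2 * z) ^ (ℓ - 2 * k)

/-- The north pole `η = (1, 0, …, 0)`. -/
def northPole (n : ℕ) [NeZero n] : Sph n :=
  ⟨EuclideanSpace.single 0 1, by simp⟩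

/-- The normalization `N^{(ℓ)} = ⟨G^{(ℓ)}, G^{(ℓ)}⟩_S`, where `G^{(ℓ)}` is identified with the zonal
function `x ↦ G^{(ℓ)}(η · x)` on the sphere. -/
def gegenbauerN (n ℓ : ℕ) [NeZero n] : ℝ :=
  sphereNormSq fun x : Sph n =>
    ((gegenbauerG n ℓ (inner ℝ (northPole n).1 x.1) : ℝ) : ℂ)

/-- The normalized Gegenbauer polynomial `γ_ℓ = G^{(ℓ)} / √N^{(ℓ)}`. -/
def gegenbauer (n ℓ : ℕ) [NeZero n] (z : ℝ) : ℝ :=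
  gegenbauerG n ℓ z / Real.sqrt (gegenbauerN n ℓ)

/-! ### The hypercube inside the sphere -/

/-- The identification of `ℤ₂ⁿ` with `H = {±1/√n}ⁿ`: the point with coordinates
`(-1)^{zᵢ} / √n`. -/
def cubePoint {n : ℕ} [NeZero n] (z : Fin n → ZMod 2) : Sph n :=
  ⟨WithLp.toLp 2 fun i => (-1 : ℝ) ^ (z i).val / Real.sqrt n, by
    have hn : (n : ℝ) ≠ 0 := Nat.cast_ne_zero.2 (NeZero.ne n)
    rw [mem_sphere_zero_iff_norm, EuclideanSpace.norm_eq, Real.sqrt_eq_one]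
    simp [hn]⟩

/-- The cubical inner product `⟨f, g⟩_H = 𝔼_{x ∈ H} f(x)^* g(x)`. -/
def cubeInner {n : ℕ} [NeZero n] (f g : Sph n → ℂ) : ℂ :=
  (1 / 2 ^ n : ℂ) *
    ∑ z : Fin n → ZMod 2, (starRingEnd ℂ) (f (cubePoint z)) * g (cubePoint z)

/-- The character `χ_k`, extended to the sphere: `χ_k(x) = ∏_{i : kᵢ = 1} √n xᵢ`. -/
def character {n : ℕ} (k : Fin n → ZMod 2) (x : Sph n) : ℂ :=
  ∏ i with k i = 1, ((Real.sqrt n * x.1 i : ℝ) : ℂ)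

/-- The Fourier coefficient at `k` of the restriction `f|_H`: `⟨f, χ_k⟩_H`. -/
def cubeCoeff {n : ℕ} [NeZero n] (f : Sph n → ℂ) (k : Fin n → ZMod 2) : ℂ :=
  cubeInner f (character k)

/-- The energy of `f|_H` at the character `k`. -/
def energy {n : ℕ} [NeZero n] (f : Sph n → ℂ) (k : Fin n → ZMod 2) : ℝ :=
  ‖cubeCoeff f k‖ ^ 2

/-- The Kravchuk polynomial `κ_k(h) = ∑_{j=0}^k (-1)^j C(k, j) C(n-k, h-j)` for `0 ≤ k, h ≤ n`, with
`C(n-k, h-j) = 0` when `j > h`. -/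
def kravchuk (n k h : ℕ) : ℤ :=
  ∑ j ∈ Finset.range (k + 1),
    if j ≤ h then (-1) ^ j * (k.choose j : ℤ) * ((n - k).choose (h - j) : ℤ) else 0

end

end SphereCube

open SphereCube

open SphereCube

namespace SphereCube

noncomputable section

/-! ### Rotations -/

/-! Expanding the square in the energy gives a double sum over cube points `z`, `w` of `χ_k(z - w)`
against `Rf(z)` times the conjugate of `Rf(w)`, so only the correlation K(x, y) = 𝔼_R Rf(x)
conj(Rf(y)), `rotKernel`, matters.

K is invariant under simultaneous rotation of its arguments, because Haar measure is left invariant,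
and it is a spherical harmonic in x for fixed y. Such a kernel is a multiple of G_ℓ(x · y)
(`exists_eq_gegenbauerG_of_invariant`): transitivity of SO_n moves y to the pole, a harmonic fixed
by the stabilizer of the pole is a combination of the x₀^(ℓ-2j) |x|^(2j), and the Laplace equation
determines the coefficients up to a scalar (`exists_eq_gegenbauerG_of_zonal`). Integrating over the
diagonal finds the scalar: K(x, y) = ‖f‖² G_ℓ(x · y) / G_ℓ(1) (`rotKernel_eq`). The division needs
G_ℓ(1) > 0, from `sum_gegCoeff_pos`.

On the cube, x · y = 1 - 2h/n with h the Hamming distance, and `χ_k` sums to κ_{|k|}(h) over the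
vectors of weight h; this gives `integral_energy`. The same classification, applied to the
reproducing kernel of the harmonics, yields N_ℓ = G_ℓ(1)² / d_ℓ (`gegenbauerN_mul_harmDim`), so that
G_ℓ / G_ℓ(1) = γ_ℓ / √d_ℓ. -/

/-- The matrix of the reflection in the hyperplane orthogonal to `v`. -/
def householder {n : ℕ} (v : Fin n → ℝ) : Matrix (Fin n) (Fin n) ℝ :=
  1 - (2 / (v ⬝ᵥ v)) • Matrix.vecMulVec v v

lemma householder_mulVec {n : ℕ} (v w : Fin n → ℝ) :
    (householder v).mulVec w = w - (2 * (v ⬝ᵥ w) / (v ⬝ᵥ v)) • v := by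
  rw [householder, Matrix.sub_mulVec, Matrix.one_mulVec, Matrix.smul_mulVec,
    Matrix.vecMulVec_mulVec]
  ext i
  simp
  ring

lemma householder_transpose {n : ℕ} (v : Fin n → ℝ) :
    (householder v).transpose = householder v := by
  ext i j
  simp [householder, Matrix.vecMulVec_apply, Matrix.one_apply, eq_comm, mul_comm]

lemma householder_mul_self {n : ℕ} {v : Fin n → ℝ} (hv : v ≠ 0) :
    householder v * householder v = 1 := by
  have hvv : v ⬝ᵥ v ≠ 0 := fun h => hv (dotProduct_self_eq_zero.1 h)
  refine Matrix.toLin'.injective (LinearMap.ext fun w => ?_)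
  simp only [Matrix.toLin'_apply, ← Matrix.mulVec_mulVec, householder_mulVec, Matrix.one_mulVec,
    dotProduct_sub, dotProduct_smul, smul_eq_mul]
  ext i
  simp
  field_simp
  ring

lemma det_householder {n : ℕ} {v : Fin n → ℝ} (hv : v ≠ 0) : (householder v).det = -1 := by
  have hvv : v ⬝ᵥ v ≠ 0 := fun h => hv (dotProduct_self_eq_zero.1 h)
  have h : householder v = 1 + Matrix.replicateCol Unit ((-(2 / (v ⬝ᵥ v))) • v) *
      Matrix.replicateRow Unit v := by
    ext i j
    simp [householder, Matrix.vecMulVec_apply, Matrix.mul_apply]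
    ring
  rw [h, Matrix.det_one_add_replicateCol_mul_replicateRow, dotProduct_smul, smul_eq_mul]
  field_simp
  norm_num

/-- For `n ≥ 3`, two vectors of equal length that have the same inner product with `e` are related
by a rotation that fixes `e`. -/
lemma exists_rotation {n : ℕ} (hn : 3 ≤ n) (e x y : Fin n → ℝ) (hxy : x ⬝ᵥ x = y ⬝ᵥ y)
    (he : e ⬝ᵥ x = e ⬝ᵥ y) : ∃ R : SO n, R.1.mulVec e = e ∧ R.1.mulVec x = y := by
  rcases eq_or_ne x y with rfl | hne
  · exact ⟨1, by simp, by simp⟩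
  -- The reflection along `x - y` sends `x` to `y` and fixes `e`, but has determinant -1. A second
  -- reflection, along some `v` orthogonal to both `y` and `e`, corrects the sign; such a `v` exists
  -- because 2 < n.
  obtain ⟨v, hv, hv0⟩ : ∃ v : Fin n → ℝ, v ∈ LinearMap.ker
      (Matrix.toLin' (Matrix.of ![y, e])) ∧ v ≠ 0 := by
    refine Submodule.exists_mem_ne_zero_of_ne_bot (LinearMap.ker_ne_bot_of_finrank_lt ?_)
    simp
    omega
  have hvy : v ⬝ᵥ y = 0 := by
    have := congrFun (LinearMap.mem_ker.1 hv) 0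
    simpa [Matrix.mulVec, dotProduct_comm] using this
  have hve : v ⬝ᵥ e = 0 := by
    have := congrFun (LinearMap.mem_ker.1 hv) 1
    simpa [Matrix.mulVec, dotProduct_comm] using this
  have hu0 : x - y ≠ 0 := sub_ne_zero.2 hne
  refine ⟨⟨householder v * householder (x - y),
    Matrix.mem_specialOrthogonalGroup_iff.2 ⟨(Matrix.mem_orthogonalGroup_iff _ _).2 ?_, ?_⟩⟩,
    ?_, ?_⟩
  · change _ * (householder v * householder (x - y)).transpose = 1
    rw [Matrix.transpose_mul, householder_transpose, householder_transpose, mul_assoc,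
      ← mul_assoc (householder (x - y)), householder_mul_self hu0, one_mul,
      householder_mul_self hv0]
  · rw [Matrix.det_mul, det_householder hv0, det_householder hu0]
    norm_num
  · have h : (x - y) ⬝ᵥ e = 0 := by
      rw [sub_dotProduct, dotProduct_comm x, dotProduct_comm y, he, sub_self]
    rw [← Matrix.mulVec_mulVec, householder_mulVec (x - y), h]
    simp [householder_mulVec, hve]
  · have h : 2 * ((x - y) ⬝ᵥ x) = (x - y) ⬝ᵥ (x - y) := by
      simp only [sub_dotProduct, dotProduct_sub, dotProduct_comm y x, hxy]
      ring
    have h' : (x - y) ⬝ᵥ (x - y) ≠ 0 := fun h => hu0 (dotProduct_self_eq_zero.1 h)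
    rw [← Matrix.mulVec_mulVec, householder_mulVec (x - y), h, div_self h', one_smul,
      sub_sub_cancel, householder_mulVec, hvy]
    simp

lemma dotProduct_self_sphere {n : ℕ} (x : Sph n) : x.1.ofLp ⬝ᵥ x.1.ofLp = 1 := by
  have := x.2
  rw [mem_sphere_zero_iff_norm, EuclideanSpace.norm_eq, Real.sqrt_eq_one] at this
  simpa [dotProduct, ← pow_two] using this

lemma inner_eq_dotProduct {n : ℕ} (x y : EuclideanSpace ℝ (Fin n)) :
    inner ℝ x y = x.ofLp ⬝ᵥ y.ofLp := by
  rw [EuclideanSpace.inner_eq_star_dotProduct, dotProduct_comm]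
  simp

@[simp] lemma rotPoint_ofLp {n : ℕ} (R : SO n) (x : Sph n) :
    (rotPoint R x).1.ofLp = R.1.mulVec x.1.ofLp := rfl

lemma sph_ext {n : ℕ} {x y : Sph n} (h : x.1.ofLp = y.1.ofLp) : x = y :=
  Subtype.ext (WithLp.ofLp_injective 2 h)

lemma rotPoint_mul {n : ℕ} (R S : SO n) (x : Sph n) :
    rotPoint (R * S) x = rotPoint R (rotPoint S x) :=
  sph_ext (by simp)

@[simp] lemma rotPoint_one {n : ℕ} (x : Sph n) : rotPoint 1 x = x :=
  sph_ext (by simp)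

@[simp] lemma rotPoint_inv_rotPoint {n : ℕ} (R : SO n) (x : Sph n) :
    rotPoint R⁻¹ (rotPoint R x) = x := by
  rw [← rotPoint_mul, inv_mul_cancel, rotPoint_one]

@[simp] lemma rotPoint_rotPoint_inv {n : ℕ} (R : SO n) (x : Sph n) :
    rotPoint R (rotPoint R⁻¹ x) = x := by
  rw [← rotPoint_mul, mul_inv_cancel, rotPoint_one]

lemma inner_rotPoint {n : ℕ} (R : SO n) (x y : Sph n) :
    inner ℝ (rotPoint R x).1 (rotPoint R y).1 = inner ℝ x.1 y.1 := by
  rw [inner_eq_dotProduct, inner_eq_dotProduct, rotPoint_ofLp, rotPoint_ofLp,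
    Matrix.dotProduct_mulVec, Matrix.vecMul_mulVec, SO_transpose_mul, Matrix.vecMul_one]

lemma continuous_rotPoint {n : ℕ} :
    Continuous fun p : SO n × Sph n => rotPoint p.1 p.2 := by
  refine Continuous.subtype_mk (f := fun p : SO n × Sph n =>
    WithLp.toLp 2 (p.1.1.mulVec p.2.1.ofLp)) ?_ _
  refine (PiLp.continuous_toLp 2 _).comp (Continuous.matrix_mulVec ?_ ?_)
  · exact continuous_subtype_val.comp continuous_fst
  · exact (PiLp.continuous_ofLp 2 _).comp (continuous_subtype_val.comp continuous_snd)

lemma exists_rotPoint_eq {n : ℕ} (hn : 3 ≤ n) (x y : Sph n) : ∃ R : SO n, rotPoint R x = y := by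
  obtain ⟨R, -, h⟩ := exists_rotation hn 0 x.1.ofLp y.1.ofLp
    (by rw [dotProduct_self_sphere, dotProduct_self_sphere]) (by simp)
  exact ⟨R, sph_ext h⟩

/-- A rotation as a linear isometry of Euclidean space. -/
def rotIsometry {n : ℕ} (R : SO n) :
    EuclideanSpace ℝ (Fin n) →ₗᵢ[ℝ] EuclideanSpace ℝ (Fin n) where
  toFun v := WithLp.toLp 2 (R.1.mulVec v.ofLp)
  map_add' v w := by simp [Matrix.mulVec_add]
  map_smul' c v := by simp [Matrix.mulVec_smul]
  norm_map' v := by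
    rw [← sq_eq_sq₀ (norm_nonneg _) (norm_nonneg _), ← real_inner_self_eq_norm_sq,
      ← real_inner_self_eq_norm_sq, inner_eq_dotProduct, inner_eq_dotProduct]
    simp [Matrix.dotProduct_mulVec, Matrix.vecMul_mulVec, SO_transpose_mul]

open scoped Pointwise in
/-- The surface measure is invariant under rotations. -/
lemma measurePreserving_rotPoint {n : ℕ} (R : SO n) :
    MeasurePreserving (rotPoint R) (volume : Measure (EuclideanSpace ℝ (Fin n))).toSphere
      (volume : Measure (EuclideanSpace ℝ (Fin n))).toSphere := by
  have hc : Continuous (rotPoint R) := continuous_rotPoint.comp (Continuous.prodMk_right R)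
  refine ⟨hc.measurable, Measure.ext fun s hs => ?_⟩
  rw [Measure.map_apply hc.measurable hs, Measure.toSphere_apply' _ (hc.measurable hs),
    Measure.toSphere_apply' _ hs]
  congr 1
  -- The surface measure of `s` is a multiple of the volume of the cone over `s`, and a linear
  -- isometry preserves volume and maps cones to cones.
  let I := (rotIsometry R).toLinearIsometryEquiv rfl
  rw [← I.measurePreserving.measure_preimage_equiv (f := I.toMeasurableEquiv)
    (Set.Ioo (0 : ℝ) 1 • (Subtype.val '' s))]
  congr 1
  ext v
  simp only [Set.mem_preimage, Set.mem_smul, Set.mem_image]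
  constructor
  · rintro ⟨t, ht, _, ⟨x, hx, rfl⟩, rfl⟩
    exact ⟨t, ht, _, ⟨_, hx, rfl⟩, (I.map_smul t x.1).symm⟩
  · rintro ⟨t, ht, _, ⟨x, hx, rfl⟩, h⟩
    refine ⟨t, ht, _, ⟨rotPoint R⁻¹ x, by simpa using hx, rfl⟩, ?_⟩
    apply I.injective
    refine ((I.map_smul t (rotPoint R⁻¹ x).1).trans ?_).trans h
    change t • (rotPoint R (rotPoint R⁻¹ x)).1 = _
    rw [rotPoint_rotPoint_inv]

/-! ### Coefficients of the Gegenbauer polynomials -/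

/-- The coefficient of `z ^ (ℓ - 2 * j)` in the Gegenbauer polynomial with parameter `α`. -/
def gegCoeff (α : ℝ) (ℓ j : ℕ) : ℝ :=
  (-1) ^ j * Real.Gamma ((ℓ : ℝ) - j + α) /
    (Real.Gamma α * (j.factorial : ℝ) * ((ℓ - 2 * j).factorial : ℝ)) * 2 ^ (ℓ - 2 * j)

lemma gegenbauerG_eq_sum_gegCoeff (n ℓ : ℕ) (z : ℝ) :
    gegenbauerG n ℓ z = ∑ j ∈ Finset.range (ℓ / 2 + 1),
      gegCoeff ((n : ℝ) / 2 - 1) ℓ j * z ^ (ℓ - 2 * j) := by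
  refine Finset.sum_congr rfl fun j _ => ?_
  simp only [gegCoeff, mul_pow, mul_assoc]

lemma gegCoeff_zero_pos {α : ℝ} (hα : 0 < α) (ℓ : ℕ) : 0 < gegCoeff α ℓ 0 := by
  have h1 : 0 < Real.Gamma ((ℓ : ℝ) + α) := Real.Gamma_pos_of_pos (by positivity)
  have h2 := Real.Gamma_pos_of_pos hα
  simp only [gegCoeff, Nat.cast_zero, sub_zero, pow_zero, one_mul, mul_zero, Nat.sub_zero]
  positivity

/-- The two-term recursion of the coefficients of the Gegenbauer polynomials. -/
lemma gegCoeff_succ {α : ℝ} (hα : 0 < α) {ℓ j : ℕ} (hj : 2 * (j + 1) ≤ ℓ) :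
    gegCoeff α ℓ (j + 1) * (4 * (j + 1) * (ℓ - j - 1 + α)) =
      -(gegCoeff α ℓ j * ((ℓ - 2 * j : ℕ) * ((ℓ - 2 * j : ℕ) - 1))) := by
  obtain ⟨m, rfl⟩ := Nat.exists_eq_add_of_le hj
  have e1 : 2 * (j + 1) + m - 2 * (j + 1) = m := by omega
  have e2 : 2 * (j + 1) + m - 2 * j = m + 2 := by omega
  have h2 := (Real.Gamma_pos_of_pos hα).ne'
  have hpos : (0 : ℝ) < j + 1 + m + α := by positivity
  have hG : Real.Gamma (((2 * (j + 1) + m : ℕ) : ℝ) - j + α) =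
      (j + 1 + m + α) * Real.Gamma (j + 1 + m + α) := by
    rw [← Real.Gamma_add_one hpos.ne']
    congr 1
    push_cast
    ring
  have hG' : Real.Gamma (((2 * (j + 1) + m : ℕ) : ℝ) - (j + 1 : ℕ) + α) =
      Real.Gamma (j + 1 + m + α) := by
    congr 1
    push_cast
    ring
  rw [gegCoeff, gegCoeff, e1, e2, hG, hG']
  push_cast [Nat.factorial_succ]
  field_simp
  ring

/-- The derivative of a Gegenbauer polynomial, coefficientwise. -/
lemma gegCoeff_mul_degree {α : ℝ} (hα : 0 < α) {ℓ j : ℕ} (hj : 2 * j ≤ ℓ) :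
    gegCoeff α (ℓ + 1) j * (ℓ + 1 - 2 * j : ℕ) = 2 * α * gegCoeff (α + 1) ℓ j := by
  obtain ⟨m, rfl⟩ := Nat.exists_eq_add_of_le hj
  have e1 : 2 * j + m + 1 - 2 * j = m + 1 := by omega
  have e2 : 2 * j + m - 2 * j = m := by omega
  have h2 := (Real.Gamma_pos_of_pos hα).ne'
  rw [gegCoeff, gegCoeff, e1, e2, Real.Gamma_add_one hα.ne']
  have : ((2 * j + m + 1 : ℕ) : ℝ) - j + α = ((2 * j + m : ℕ) : ℝ) - j + (α + 1) := by
    push_cast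
    ring
  rw [this]
  push_cast [Nat.factorial_succ]
  field_simp
  ring

/-- The Gegenbauer differential equation at `1`. -/
lemma sum_gegCoeff_ode {α : ℝ} (hα : 0 < α) (ℓ : ℕ) :
    ℓ * (ℓ + 2 * α) * ∑ j ∈ Finset.range (ℓ / 2 + 1), gegCoeff α ℓ j =
      (2 * α + 1) * ∑ j ∈ Finset.range (ℓ / 2 + 1), gegCoeff α ℓ j * (ℓ - 2 * j : ℕ) := by
  -- Termwise, the difference of the two sides is `u j + v j`. The coefficient recursion says `u (j
  -- + 1) = -v j`, while `u 0 = 0` and `v (ℓ / 2) = 0`, so the total telescopes to zero.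
  let u : ℕ → ℝ := fun j => gegCoeff α ℓ j * (4 * j * (ℓ - j + α))
  let v : ℕ → ℝ := fun j => gegCoeff α ℓ j * ((ℓ - 2 * j : ℕ) * ((ℓ - 2 * j : ℕ) - 1))
  have huv : ∑ j ∈ Finset.range (ℓ / 2 + 1), u j = - ∑ j ∈ Finset.range (ℓ / 2 + 1), v j := by
    have hv : v (ℓ / 2) = 0 := by
      rcases (by omega : ℓ - 2 * (ℓ / 2) = 0 ∨ ℓ - 2 * (ℓ / 2) = 1) with h | h <;> simp [v, h]
    rw [Finset.sum_range_succ', Finset.sum_range_succ, hv, add_zero, ← Finset.sum_neg_distrib]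
    simp only [u, Nat.cast_zero, mul_zero, zero_mul, add_zero]
    refine Finset.sum_congr rfl fun j hj => ?_
    have h : 2 * (j + 1) ≤ ℓ := by have := Finset.mem_range.1 hj; omega
    rw [← gegCoeff_succ hα h]
    push_cast
    ring
  rw [← sub_eq_zero, Finset.mul_sum, Finset.mul_sum, ← Finset.sum_sub_distrib]
  rw [← add_eq_zero_iff_eq_neg, ← Finset.sum_add_distrib] at huv
  rw [← huv]
  refine Finset.sum_congr rfl fun j hj => ?_
  have h : 2 * j ≤ ℓ := by have := Finset.mem_range.1 hj; omega
  simp only [u, v]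
  rw [Nat.cast_sub h]
  push_cast
  ring

/-- The differential equation at 1 makes the value a positive multiple of the derivative there, and
the derivative is 2α times the polynomial of degree one less with parameter α + 1. Hence the
induction must leave α free. -/
lemma sum_gegCoeff_pos (ℓ : ℕ) : ∀ {α : ℝ}, 0 < α →
    0 < ∑ j ∈ Finset.range (ℓ / 2 + 1), gegCoeff α ℓ j := by
  induction ℓ with
  | zero =>
    intro α hα
    simpa using gegCoeff_zero_pos hα 0
  | succ ℓ ih =>
    intro α hα
    have h := sum_gegCoeff_ode hα (ℓ + 1)
    have hd : ∑ j ∈ Finset.range ((ℓ + 1) / 2 + 1), gegCoeff α (ℓ + 1) j * (ℓ + 1 - 2 * j : ℕ) =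
        2 * α * ∑ j ∈ Finset.range (ℓ / 2 + 1), gegCoeff (α + 1) ℓ j := by
      rw [Finset.mul_sum]
      have hs : Finset.range (ℓ / 2 + 1) ⊆ Finset.range ((ℓ + 1) / 2 + 1) :=
        Finset.range_subset_range.2 (by omega)
      -- When ℓ + 1 is even, the longer range has one more index, the constant term, which
      -- differentiation kills.
      rw [← Finset.sum_subset hs]
      · refine Finset.sum_congr rfl fun j hj => gegCoeff_mul_degree hα ?_
        have := Finset.mem_range.1 hj
        omega
      · intro j _ hj
        have : ℓ + 1 - 2 * j = 0 := by
          have := mt Finset.mem_range.2 hj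
          omega
        simp [this]
    rw [hd] at h
    have := ih (α := α + 1) (by positivity)
    refine pos_of_mul_pos_right (a := ((ℓ + 1 : ℕ) : ℝ) * ((ℓ + 1 : ℕ) + 2 * α)) ?_ (by positivity)
    rw [h]
    positivity

lemma gegenbauerG_one_pos {n : ℕ} (hn : 3 ≤ n) (ℓ : ℕ) : 0 < gegenbauerG n ℓ 1 := by
  have hn' : (3 : ℝ) ≤ n := by exact_mod_cast hn
  simpa [gegenbauerG_eq_sum_gegCoeff] using
    sum_gegCoeff_pos ℓ (α := (n : ℝ) / 2 - 1) (by linarith)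

/-! ### Zonal harmonics -/

lemma eval_mul_of_isHomogeneous {n ℓ : ℕ} {p : MvPolynomial (Fin n) ℂ} (hp : p.IsHomogeneous ℓ)
    (c : ℂ) (x : Fin n → ℂ) :
    MvPolynomial.eval (fun i => c * x i) p = c ^ ℓ * MvPolynomial.eval x p := by
  rw [MvPolynomial.eval_eq, MvPolynomial.eval_eq, Finset.mul_sum]
  refine Finset.sum_congr rfl fun d hd => ?_
  simp only [mul_pow]
  rw [Finset.prod_mul_distrib, Finset.prod_pow_eq_pow_sum, ← hp.degree_eq_sum_deg_support hd]
  ring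

/-- The polynomial `∑ᵢ xᵢ²`. -/
def normSqPoly (n : ℕ) : MvPolynomial (Fin n) ℂ := ∑ i, MvPolynomial.X i ^ 2

lemma pderiv_normSqPoly {n : ℕ} (i : Fin n) :
    MvPolynomial.pderiv i (normSqPoly n) = 2 * MvPolynomial.X i := by
  classical
  simp only [normSqPoly, map_sum, Derivation.leibniz_pow, MvPolynomial.pderiv_X]
  rw [Finset.sum_eq_single i]
  · simp
  · intro j _ hj
    simp [hj]
  · simp

lemma polyLaplacian_apply {n : ℕ} (p : MvPolynomial (Fin n) ℂ) :
    polyLaplacian n p = ∑ i, MvPolynomial.pderiv i (MvPolynomial.pderiv i p) := by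
  simp [polyLaplacian, LinearMap.sum_apply]

/-- The Laplacian of `x₀ᵃ |x|²ᵇ` at a point with `x₀ = 1` and `|x|² = u`. -/
lemma eval_polyLaplacian_monomial {n : ℕ} [NeZero n] (a b : ℕ) (u : ℂ) (x : Fin n → ℂ)
    (hx0 : x 0 = 1) (hx : ∑ i, x i ^ 2 = u) :
    MvPolynomial.eval x (polyLaplacian n (MvPolynomial.X 0 ^ a * normSqPoly n ^ b)) =
      a * (a - 1) * u ^ b + b * (4 * a + 4 * (b - 1) + 2 * n) * u ^ (b - 1) := by
  have hr : MvPolynomial.eval x (normSqPoly n) = u := by simp [normSqPoly, hx]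
  have key : ∀ i, MvPolynomial.eval x (MvPolynomial.pderiv i (MvPolynomial.pderiv i
      (MvPolynomial.X 0 ^ a * normSqPoly n ^ b))) =
      (if i = 0 then (a * (a - 1 : ℕ) * u ^ b + 4 * a * b * u ^ (b - 1) : ℂ) else 0) +
        4 * b * (b - 1 : ℕ) * u ^ (b - 1 - 1) * x i ^ 2 + 2 * b * u ^ (b - 1) := by
    intro i
    have h2 : MvPolynomial.pderiv i (2 : MvPolynomial (Fin n) ℂ) = 0 := by
      rw [← map_ofNat (MvPolynomial.C (σ := Fin n) (R := ℂ)) 2, MvPolynomial.pderiv_C]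
    by_cases h : i = 0
    · subst h
      simp [Derivation.leibniz, Derivation.leibniz_pow, pderiv_normSqPoly, hr, hx0, h2]
      ring
    · have h' : MvPolynomial.pderiv i (MvPolynomial.X (R := ℂ) (0 : Fin n)) = 0 := by
        classical
        simp [MvPolynomial.pderiv_X, Ne.symm h]
      simp [Derivation.leibniz, Derivation.leibniz_pow, pderiv_normSqPoly, hr, hx0, h2, h', h]
      ring
  rw [polyLaplacian_apply, map_sum, Finset.sum_congr rfl fun i _ => key i,
    Finset.sum_add_distrib, Finset.sum_add_distrib, ← Finset.mul_sum, hx]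
  -- Truncated subtraction in the exponents and factors is harmless: wherever it truncates, a factor
  -- vanishes.
  have hb : (b : ℂ) * (b - 1 : ℕ) * u ^ (b - 1 - 1) * u = b * (b - 1) * u ^ (b - 1) := by
    rcases b with _ | _ | b <;> simp [pow_succ, mul_assoc]
  have ha : (a : ℂ) * (a - 1 : ℕ) = a * (a - 1) := by
    rcases a with _ | a <;> simp
  simp only [Finset.sum_ite_eq', Finset.mem_univ, if_true, Finset.sum_const, Finset.card_univ,
    Fintype.card_fin, nsmul_eq_mul]
  linear_combination 4 * hb + u ^ b * ha

/-- Complex points are used so that |x|² takes every value `u` even with x₀ = 1; an identity at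
these points is then an identity of polynomials in `u`. -/
lemma exists_sum_sq_eq {n : ℕ} [NeZero n] (hn : 2 ≤ n) (u : ℂ) :
    ∃ x : Fin n → ℂ, x 0 = 1 ∧ ∑ i, x i ^ 2 = u := by
  obtain ⟨w, hw⟩ := IsAlgClosed.exists_pow_nat_eq (u - 1) (n := 2) (by norm_num)
  let i₁ : Fin n := ⟨1, by omega⟩
  have h01 : (0 : Fin n) ≠ i₁ := by simp [Fin.ext_iff, i₁]
  refine ⟨fun i => if i = 0 then 1 else if i = i₁ then w else 0, by simp, ?_⟩
  rw [Finset.sum_eq_add (0 : Fin n) i₁ h01]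
  · simp [h01.symm, hw]
  · rintro c - ⟨h0, h1⟩
    simp [h0, h1]
  · simp
  · simp

/-- The coefficients of a harmonic polynomial `∑ⱼ aⱼ x₀^(ℓ-2j) |x|^(2j)` satisfy the recursion of
the Gegenbauer coefficients. -/
lemma recursion_of_polyLaplacian_eq_zero {n : ℕ} [NeZero n] (hn : 2 ≤ n) {ℓ : ℕ} (a : ℕ → ℂ)
    (h : polyLaplacian n (∑ j ∈ Finset.range (ℓ / 2 + 1),
      a j • (MvPolynomial.X 0 ^ (ℓ - 2 * j) * normSqPoly n ^ j)) = 0)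
    {j : ℕ} (hj : 2 * (j + 1) ≤ ℓ) :
    a (j + 1) * (4 * (j + 1) * (ℓ - j - 1 + (n / 2 - 1))) =
      -(a j * ((ℓ - 2 * j : ℕ) * ((ℓ - 2 * j : ℕ) - 1))) := by
  let b : ℕ → ℂ := fun j => a j * ((ℓ - 2 * j : ℕ) * ((ℓ - 2 * j : ℕ) - 1)) +
    a (j + 1) * (4 * (j + 1) * (ℓ - j - 1 + (n / 2 - 1)))
  -- On x₀ = 1, |x|² = u, the Laplacian is a polynomial in `u` with coefficients `b j`, once the
  -- |x|² contributions are shifted by one index. It vanishes for all `u`, so each `b j` is zero.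
  have hb : ∑ j ∈ Finset.range (ℓ / 2), Polynomial.C (b j) * Polynomial.X ^ j = 0 := by
    refine Polynomial.funext fun u => ?_
    obtain ⟨x, hx0, hx⟩ := exists_sum_sq_eq hn u
    have h1 := congrArg (MvPolynomial.eval x) h
    rw [map_sum, map_sum, map_zero] at h1
    simp only [map_smul, MvPolynomial.smul_eval,
      eval_polyLaplacian_monomial _ _ u x hx0 hx, mul_add] at h1
    rw [Finset.sum_add_distrib, Finset.sum_range_succ, Finset.sum_range_succ'] at h1
    have h2 : (((ℓ - 2 * (ℓ / 2) : ℕ) : ℂ) * ((ℓ - 2 * (ℓ / 2) : ℕ) - 1)) = 0 := by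
      rcases (by omega : ℓ - 2 * (ℓ / 2) = 0 ∨ ℓ - 2 * (ℓ / 2) = 1) with h | h <;> simp [h]
    rw [h2] at h1
    simp only [Nat.cast_zero, zero_mul, mul_zero, add_zero, ← Finset.sum_add_distrib] at h1
    rw [Polynomial.eval_finsetSum, Polynomial.eval_zero, ← h1]
    refine Finset.sum_congr rfl fun j hj => ?_
    have hj' : 2 * (j + 1) ≤ ℓ := by have := Finset.mem_range.1 hj; omega
    simp only [Polynomial.eval_mul, Polynomial.eval_C, Polynomial.eval_pow, Polynomial.eval_X, b,
      Nat.add_sub_cancel]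
    rw [Nat.cast_sub hj']
    push_cast
    ring
  have hj' : j < ℓ / 2 := by omega
  have := congrArg (fun q => Polynomial.coeff q j) hb
  simp only [Polynomial.finsetSum_coeff, Polynomial.coeff_C_mul_X_pow, Polynomial.coeff_zero,
    Finset.sum_ite_eq, Finset.mem_range, hj', if_true, b] at this
  linear_combination this

/-- A harmonic polynomial `∑ⱼ aⱼ x₀^(ℓ-2j) |x|^(2j)` is a multiple of the Gegenbauer one. -/
lemma coeff_eq_gegCoeff {n : ℕ} [NeZero n] (hn : 3 ≤ n) {ℓ : ℕ} (a : ℕ → ℂ)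
    (h : polyLaplacian n (∑ j ∈ Finset.range (ℓ / 2 + 1),
      a j • (MvPolynomial.X 0 ^ (ℓ - 2 * j) * normSqPoly n ^ j)) = 0) :
    ∃ c : ℂ, ∀ j, 2 * j ≤ ℓ → a j = c * gegCoeff ((n : ℝ) / 2 - 1) ℓ j := by
  have hα : (0 : ℝ) < (n : ℝ) / 2 - 1 := by
    have : (3 : ℝ) ≤ n := by exact_mod_cast hn
    linarith
  have h0 : (gegCoeff ((n : ℝ) / 2 - 1) ℓ 0 : ℂ) ≠ 0 := by
    exact_mod_cast (gegCoeff_zero_pos hα ℓ).ne'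
  refine ⟨a 0 / gegCoeff ((n : ℝ) / 2 - 1) ℓ 0, fun j => ?_⟩
  induction j with
  | zero => intro _; exact (div_mul_cancel₀ _ h0).symm
  | succ j ih =>
    intro hj
    have h1 := recursion_of_polyLaplacian_eq_zero (by omega) a h hj
    have h2 := congrArg (fun t : ℝ => (t : ℂ)) (gegCoeff_succ hα hj)
    push_cast at h2
    have h3 : (4 * ((j : ℂ) + 1) * (ℓ - j - 1 + (n / 2 - 1))) ≠ 0 := by
      have : (0 : ℝ) < 4 * ((j : ℝ) + 1) * (ℓ - j - 1 + (n / 2 - 1)) := by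
        have h4 : (2 * (j + 1) : ℝ) ≤ ℓ := by exact_mod_cast hj
        have h5 : (0 : ℝ) ≤ j := by positivity
        refine mul_pos (by positivity) ?_
        linarith
      have h6 := Complex.ofReal_ne_zero.2 this.ne'
      push_cast at h6
      exact h6
    rw [ih (by omega)] at h1
    refine mul_right_cancel₀ h3 ?_
    rw [h1]
    linear_combination (-(a 0 / gegCoeff ((n : ℝ) / 2 - 1) ℓ 0)) * h2

/-- The point of the unit sphere in the direction of a nonzero vector. -/
lemma exists_sphere_smul {n : ℕ} {v : Fin n → ℝ} (hv : v ≠ 0) :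
    ∃ x : Sph n, ∀ i, v i = Real.sqrt (v ⬝ᵥ v) * x.1 i := by
  have h0 : 0 < v ⬝ᵥ v := (Finset.sum_nonneg fun i _ => mul_self_nonneg (v i)).lt_of_ne'
    fun h => hv (dotProduct_self_eq_zero.1 h)
  have hs : Real.sqrt (v ⬝ᵥ v) ≠ 0 := (Real.sqrt_pos.2 h0).ne'
  refine ⟨⟨WithLp.toLp 2 ((Real.sqrt (v ⬝ᵥ v))⁻¹ • v), ?_⟩, fun i => ?_⟩
  · rw [mem_sphere_zero_iff_norm, EuclideanSpace.norm_eq, Real.sqrt_eq_one]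
    have : ∑ i, v i ^ 2 = v ⬝ᵥ v := by simp [dotProduct, pow_two]
    simp only [Pi.smul_apply, smul_eq_mul, norm_mul, mul_pow, ← Finset.mul_sum]
    simp only [Real.norm_eq_abs, sq_abs, this, inv_pow, Real.sq_sqrt h0.le]
    exact inv_mul_cancel₀ h0.ne'
  · simp [hs]

/-- A homogeneous polynomial whose restriction to the sphere is zonal takes equal values at real
vectors of equal length and equal first coordinate. -/
lemma eval_eq_of_zonal {n : ℕ} [NeZero n] (hn : 3 ≤ n) {ℓ : ℕ} {p : MvPolynomial (Fin n) ℂ}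
    (hp : p.IsHomogeneous ℓ)
    (hz : ∀ S : SO n, rotPoint S (northPole n) = northPole n →
      ∀ x, restrictToSphere n p (rotPoint S x) = restrictToSphere n p x)
    {v w : Fin n → ℝ} (hv : v ≠ 0) (hvw : v ⬝ᵥ v = w ⬝ᵥ w) (h0 : v 0 = w 0) :
    MvPolynomial.eval (fun i => (v i : ℂ)) p = MvPolynomial.eval (fun i => (w i : ℂ)) p := by
  have hw : w ≠ 0 := by
    rintro rfl
    exact hv (dotProduct_self_eq_zero.1 (by simpa using hvw))
  obtain ⟨x, hx⟩ := exists_sphere_smul hv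
  obtain ⟨y, hy⟩ := exists_sphere_smul hw
  rw [← hvw] at hy
  have hs : Real.sqrt (v ⬝ᵥ v) ≠ 0 := by
    intro h
    exact hv (funext fun i => by rw [hx i, h, zero_mul]; rfl)
  have hxy : x.1 0 = y.1 0 := mul_left_cancel₀ hs (by rw [← hx, ← hy, h0])
  obtain ⟨S, hS, hSx⟩ := exists_rotation hn (northPole n).1.ofLp x.1.ofLp y.1.ofLp
    (by rw [dotProduct_self_sphere, dotProduct_self_sphere]) (by simp [northPole, hxy])
  have h := hz S (sph_ext hS) x
  rw [show rotPoint S x = y from sph_ext hSx] at h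
  change MvPolynomial.eval (fun i => ((y.1 i : ℝ) : ℂ)) p =
    MvPolynomial.eval (fun i => ((x.1 i : ℝ) : ℂ)) p at h
  simp only [hx, hy, Complex.ofReal_mul]
  rw [eval_mul_of_isHomogeneous hp, eval_mul_of_isHomogeneous hp, h]

/-- The span of the polynomials `x₀^(ℓ-2j) |x|^(2j)`. -/
def zonalSpan (n ℓ : ℕ) [NeZero n] : Submodule ℂ (MvPolynomial (Fin n) ℂ) :=
  Submodule.span ℂ ((fun j => MvPolynomial.X 0 ^ (ℓ - 2 * j) * normSqPoly n ^ j) ''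
    (Finset.range (ℓ / 2 + 1) : Set ℕ))

lemma mem_zonalSpan {n : ℕ} [NeZero n] {ℓ j : ℕ} (hj : 2 * j ≤ ℓ) :
    MvPolynomial.X 0 ^ (ℓ - 2 * j) * (normSqPoly n - MvPolynomial.X 0 ^ 2) ^ j ∈
      zonalSpan n ℓ := by
  rw [sub_eq_add_neg, add_pow, Finset.mul_sum]
  refine Submodule.sum_mem _ fun i hi => ?_
  have hij : i ≤ j := by have := Finset.mem_range.1 hi; omega
  have h : MvPolynomial.X 0 ^ (ℓ - 2 * j) * (normSqPoly n ^ i *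
      (-MvPolynomial.X 0 ^ 2) ^ (j - i) * ((j.choose i : ℕ) : MvPolynomial (Fin n) ℂ)) =
      ((-1) ^ (j - i) * (j.choose i : ℂ)) •
        (MvPolynomial.X 0 ^ (ℓ - 2 * i) * normSqPoly n ^ i) := by
    have : ℓ - 2 * i = ℓ - 2 * j + 2 * (j - i) := by omega
    rw [MvPolynomial.smul_eq_C_mul, this, pow_add, pow_mul, neg_pow]
    simp
    ring
  rw [h]
  refine Submodule.smul_mem _ _ (Submodule.subset_span ⟨i, ?_, rfl⟩)
  simp
  omega

/-- Zonality reduces `p` to its values on the plane of the first two coordinates: p(v) = p(v₀, s, 0,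
…) for both square roots s of ρ = |v|² - v₀². Averaging over the sign of s removes odd powers, and
the even ones are polynomials in ρ. -/
lemma mem_zonalSpan_of_zonal {n : ℕ} [NeZero n] (hn : 3 ≤ n) {ℓ : ℕ}
    {p : MvPolynomial (Fin n) ℂ} (hp : p.IsHomogeneous ℓ)
    (hz : ∀ S : SO n, rotPoint S (northPole n) = northPole n →
      ∀ x, restrictToSphere n p (rotPoint S x) = restrictToSphere n p x) :
    p ∈ zonalSpan n ℓ := by
  let i₁ : Fin n := ⟨1, by omega⟩
  have h01 : i₁ ≠ (0 : Fin n) := by simp [Fin.ext_iff, i₁]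
  -- `Q` is `p` restricted to the line (1, X, 0, …); homogeneity recovers `p` on the plane wherever
  -- t ≠ 0.
  let g : Fin n → Polynomial ℂ := fun i => if i = 0 then 1 else if i = i₁ then Polynomial.X else 0
  let Q : Polynomial ℂ := MvPolynomial.aeval g p
  have hQ : Q.natDegree < ℓ + 1 := by
    refine Nat.lt_succ_of_le ((MvPolynomial.aeval_natDegree_le (m := ℓ) (n := 1) p
      hp.totalDegree_le g fun i => ?_).trans (by simp))
    simp only [g]
    split_ifs <;> simp
  have hev : ∀ (t s : ℝ), t ≠ 0 → MvPolynomial.eval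
      (fun i => (((if i = 0 then t else if i = i₁ then s else 0 : ℝ)) : ℂ)) p =
        ∑ i ∈ Finset.range (ℓ + 1), Q.coeff i * ((t : ℂ) ^ (ℓ - i) * (s : ℂ) ^ i) := by
    intro t s ht
    have ht' : (t : ℂ) ≠ 0 := by exact_mod_cast ht
    have h1 : (fun i : Fin n => (((if i = 0 then t else if i = i₁ then s else 0 : ℝ)) : ℂ)) =
        fun i => (t : ℂ) * (g i).eval (s / t : ℂ) := by
      funext i
      simp only [g]
      split_ifs <;> simp [mul_div_cancel₀, ht']
    have h2 : MvPolynomial.eval (fun i => (g i).eval (s / t : ℂ)) p = Q.eval (s / t : ℂ) := by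
      have := MvPolynomial.comp_aeval_apply g (Polynomial.aeval (s / t : ℂ)) p
      simp only [Polynomial.coe_aeval_eq_eval] at this
      rw [this]
      rfl
    rw [h1, eval_mul_of_isHomogeneous hp, h2, Polynomial.eval_eq_sum_range' hQ, Finset.mul_sum]
    refine Finset.sum_congr rfl fun i hi => ?_
    have : ℓ = ℓ - i + i := by have := Finset.mem_range.1 hi; omega
    nth_rw 1 [this]
    rw [pow_add, div_pow]
    field_simp
  have hdot : ∀ t s : ℝ, (fun i : Fin n => if i = 0 then t else if i = i₁ then s else 0) ⬝ᵥ
      (fun i : Fin n => if i = 0 then t else if i = i₁ then s else 0) = t ^ 2 + s ^ 2 := by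
    intro t s
    rw [dotProduct, Finset.sum_eq_add (0 : Fin n) i₁ h01.symm]
    · simp [h01, pow_two]
    · rintro c - ⟨h0, h1⟩
      simp [h0, h1]
    · simp
    · simp
  have hpeq : p = ∑ i ∈ Finset.range (ℓ + 1), (if Even i then Q.coeff i else 0) •
      (MvPolynomial.X 0 ^ (ℓ - i) * (normSqPoly n - MvPolynomial.X 0 ^ 2) ^ (i / 2)) := by
    -- Real points with all coordinates nonzero suffice to identify polynomials, and they ensure v₀
    -- ≠ 0, which `hev` requires.
    refine MvPolynomial.funext_set (fun _ => Complex.ofReal '' {0}ᶜ) (fun _ => ?_) fun y hy => ?_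
    · exact ((Set.finite_singleton (0 : ℝ)).infinite_compl).image Complex.ofReal_injective.injOn
    choose v hv hvy using fun i => hy i (Set.mem_univ i)
    obtain rfl : (fun i => (v i : ℂ)) = y := funext hvy
    have hv0 : v 0 ≠ 0 := hv 0
    have hvne : v ≠ 0 := fun h => hv0 (by rw [h]; rfl)
    let ρ : ℝ := v ⬝ᵥ v - v 0 ^ 2
    have hρ : 0 ≤ ρ := by
      have : v 0 * v 0 ≤ ∑ l, v l * v l :=
        Finset.single_le_sum (f := fun l => v l * v l)
          (fun l _ => mul_self_nonneg _) (Finset.mem_univ 0)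
      simp only [ρ, dotProduct]
      nlinarith
    have h1 : ∀ s : ℝ, s ^ 2 = ρ → MvPolynomial.eval (fun i => (v i : ℂ)) p =
        ∑ i ∈ Finset.range (ℓ + 1), Q.coeff i * ((v 0 : ℂ) ^ (ℓ - i) * (s : ℂ) ^ i) := by
      intro s hs
      rw [← hev (v 0) s hv0]
      refine eval_eq_of_zonal hn hp hz (w := fun i => if i = 0 then v 0 else
        if i = i₁ then s else 0) hvne ?_ (by simp)
      rw [hdot, hs]
      simp [ρ]
    have hp1 := h1 (Real.sqrt ρ) (Real.sq_sqrt hρ)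
    have hp2 := h1 (-Real.sqrt ρ) (by rw [neg_sq, Real.sq_sqrt hρ])
    have hp3 : MvPolynomial.eval (fun i => (v i : ℂ)) p = ∑ i ∈ Finset.range (ℓ + 1),
        ((Q.coeff i * ((v 0 : ℂ) ^ (ℓ - i) * (Real.sqrt ρ : ℂ) ^ i) +
          Q.coeff i * ((v 0 : ℂ) ^ (ℓ - i) * ((-Real.sqrt ρ : ℝ) : ℂ) ^ i)) / 2) := by
      rw [← Finset.sum_div, Finset.sum_add_distrib, ← hp1, ← hp2]
      ring
    rw [hp3, map_sum]
    refine Finset.sum_congr rfl fun i _ => ?_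
    rw [MvPolynomial.smul_eval]
    have hρ' : MvPolynomial.eval (fun i => (v i : ℂ)) (normSqPoly n - MvPolynomial.X 0 ^ 2) =
        (Real.sqrt ρ : ℂ) ^ 2 := by
      rw [← Complex.ofReal_pow, Real.sq_sqrt hρ]
      simp [normSqPoly, ρ, dotProduct, pow_two]
    rw [map_mul, map_pow, map_pow, hρ', MvPolynomial.eval_X, ← pow_mul, Complex.ofReal_neg]
    by_cases hi : Even i
    · rw [if_pos hi, hi.neg_pow, Nat.two_mul_div_two_of_even hi]
      ring
    · rw [if_neg hi, (Nat.not_even_iff_odd.1 hi).neg_pow]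
      ring
  rw [hpeq]
  refine Submodule.sum_mem _ fun i hi => ?_
  by_cases h : Even i
  · obtain ⟨j, rfl⟩ := h
    have hj : 2 * j ≤ ℓ := by have := Finset.mem_range.1 hi; omega
    have := mem_zonalSpan (n := n) hj
    rw [← two_mul, Nat.mul_div_cancel_left j (by norm_num)]
    exact Submodule.smul_mem _ _ this
  · simp [h]

/-- A zonal spherical harmonic of degree `ℓ` is a multiple of the Gegenbauer polynomial. -/
theorem exists_eq_gegenbauerG_of_zonal {n : ℕ} [NeZero n] (hn : 3 ≤ n) {ℓ : ℕ} {u : Sph n → ℂ}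
    (hu : u ∈ sphericalHarmonics n ℓ)
    (hz : ∀ S : SO n, rotPoint S (northPole n) = northPole n → ∀ x, u (rotPoint S x) = u x) :
    ∃ c : ℂ, ∀ x, u x = c * gegenbauerG n ℓ (inner ℝ (northPole n).1 x.1) := by
  obtain ⟨p, ⟨hp, hΔ⟩, rfl⟩ := hu
  have hmem := mem_zonalSpan_of_zonal hn ((MvPolynomial.mem_homogeneousSubmodule _ _).1 hp) hz
  rw [zonalSpan, Submodule.mem_span_image_finset_iff_exists_fun'] at hmem
  obtain ⟨a, rfl⟩ := hmem
  obtain ⟨c, hc⟩ := coeff_eq_gegCoeff hn a (LinearMap.mem_ker.1 hΔ)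
  refine ⟨c, fun x => ?_⟩
  have hr : MvPolynomial.eval (fun i => ((x.1 i : ℝ) : ℂ)) (normSqPoly n) = 1 := by
    have := congrArg (fun t : ℝ => (t : ℂ)) (dotProduct_self_sphere x)
    simpa [normSqPoly, dotProduct, pow_two] using this
  have h0 : inner ℝ (northPole n).1 x.1 = x.1 0 := by
    rw [inner_eq_dotProduct]
    simp [northPole]
  rw [h0, gegenbauerG_eq_sum_gegCoeff]
  change MvPolynomial.eval (fun i => ((x.1 i : ℝ) : ℂ)) _ = _
  rw [map_sum, Complex.ofReal_sum, Finset.mul_sum]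
  refine Finset.sum_congr rfl fun j hj => ?_
  rw [MvPolynomial.smul_eval, map_mul, map_pow, map_pow, hr, MvPolynomial.eval_X,
    hc j (by have := Finset.mem_range.1 hj; omega)]
  push_cast
  ring

/-! ### The space of spherical harmonics -/

instance instFiniteSphericalHarmonics (n ℓ : ℕ) : Module.Finite ℂ (sphericalHarmonics n ℓ) := by
  have h1 : Module.Finite ℂ (MvPolynomial.homogeneousSubmodule (Fin n) ℂ ℓ) :=
    Module.Finite.iff_fg.2 (MvPolynomial.homogeneousSubmodule_fg _ _ ℓ)
  exact Module.Finite.iff_fg.2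
    ((Submodule.FG.of_le (Module.Finite.iff_fg.1 h1) inf_le_left).map _)

lemma continuous_of_mem_sphericalHarmonics {n ℓ : ℕ} {u : Sph n → ℂ}
    (hu : u ∈ sphericalHarmonics n ℓ) : Continuous u := by
  obtain ⟨p, -, rfl⟩ := hu
  refine (MvPolynomial.continuous_eval p).comp (continuous_pi fun i => ?_)
  exact Complex.continuous_ofReal.comp
    ((continuous_apply i).comp ((PiLp.continuous_ofLp 2 _).comp continuous_subtype_val))

/-- The linear substitution `xᵢ ↦ ∑ⱼ Mᵢⱼ xⱼ`. -/
def linSubst {n : ℕ} (M : Matrix (Fin n) (Fin n) ℝ) :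
    MvPolynomial (Fin n) ℂ →ₐ[ℂ] MvPolynomial (Fin n) ℂ :=
  MvPolynomial.aeval fun i => ∑ j, MvPolynomial.C ((M i j : ℝ) : ℂ) * MvPolynomial.X j

lemma eval_linSubst {n : ℕ} (M : Matrix (Fin n) (Fin n) ℝ) (p : MvPolynomial (Fin n) ℂ)
    (x : Fin n → ℝ) :
    MvPolynomial.eval (fun i => (x i : ℂ)) (linSubst M p) =
      MvPolynomial.eval (fun i => ((M.mulVec x i : ℝ) : ℂ)) p := by
  induction p using MvPolynomial.induction_on with
  | C a => simp [linSubst]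
  | add p q hp hq => simp [hp, hq]
  | mul_X p i hp =>
    rw [map_mul, map_mul, map_mul, hp]
    simp [linSubst, Matrix.mulVec, dotProduct]

/-- This is the chain rule for a linear change of variables. -/
lemma pderiv_linSubst {n : ℕ} (M : Matrix (Fin n) (Fin n) ℝ) (j : Fin n)
    (p : MvPolynomial (Fin n) ℂ) :
    MvPolynomial.pderiv j (linSubst M p) =
      ∑ i, MvPolynomial.C ((M i j : ℝ) : ℂ) * linSubst M (MvPolynomial.pderiv i p) := by
  classical
  have hX : ∀ i, MvPolynomial.pderiv j (linSubst M (MvPolynomial.X i)) =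
      MvPolynomial.C ((M i j : ℝ) : ℂ) := by
    intro i
    simp [linSubst, MvPolynomial.pderiv_X, Pi.single_apply]
  induction p using MvPolynomial.induction_on with
  | C a => simp [linSubst]
  | add p q hp hq => simp [hp, hq, mul_add, Finset.sum_add_distrib]
  | mul_X p k hp =>
    rw [map_mul, Derivation.leibniz, hp, hX]
    simp only [Derivation.leibniz, MvPolynomial.pderiv_X, map_add, smul_eq_mul, map_mul, mul_add,
      Finset.sum_add_distrib, Finset.mul_sum]
    congr 1
    · rw [Finset.sum_eq_single k]
      · simp [mul_comm]
      · intro i _ hi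
        simp [Ne.symm hi]
      · simp
    · refine Finset.sum_congr rfl fun i _ => ?_
      ring

/-- The Laplacian commutes with orthogonal substitutions. -/
lemma polyLaplacian_linSubst {n : ℕ} {M : Matrix (Fin n) (Fin n) ℝ} (hM : M * M.transpose = 1)
    (p : MvPolynomial (Fin n) ℂ) :
    polyLaplacian n (linSubst M p) = linSubst M (polyLaplacian n p) := by
  have hM' : ∀ i k, ∑ j, MvPolynomial.C (σ := Fin n) ((M i j : ℝ) : ℂ) *
      MvPolynomial.C ((M k j : ℝ) : ℂ) = if i = k then 1 else 0 := by
    intro i k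
    have h := congrArg (fun t : ℝ => MvPolynomial.C (σ := Fin n) (t : ℂ))
      (congrFun (congrFun hM i) k)
    simp only [Matrix.mul_apply, Matrix.transpose_apply, Matrix.one_apply, Complex.ofReal_sum,
      Complex.ofReal_mul, map_sum, map_mul] at h
    rw [h]
    split_ifs <;> simp
  have h1 : ∀ j, MvPolynomial.pderiv j (MvPolynomial.pderiv j (linSubst M p)) =
      ∑ i, ∑ k, MvPolynomial.C ((M i j : ℝ) : ℂ) * MvPolynomial.C ((M k j : ℝ) : ℂ) *
        linSubst M (MvPolynomial.pderiv k (MvPolynomial.pderiv i p)) := by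
    intro j
    rw [pderiv_linSubst, map_sum]
    refine Finset.sum_congr rfl fun i _ => ?_
    rw [Derivation.leibniz, MvPolynomial.pderiv_C, smul_zero, add_zero, pderiv_linSubst,
      smul_eq_mul, Finset.mul_sum]
    exact Finset.sum_congr rfl fun k _ => by ring
  rw [polyLaplacian_apply, polyLaplacian_apply, map_sum, Finset.sum_congr rfl fun j _ => h1 j,
    Finset.sum_comm]
  refine Finset.sum_congr rfl fun i _ => ?_
  rw [Finset.sum_comm]
  simp only [← Finset.sum_mul, hM']
  simp

/-- The space of spherical harmonics is invariant under rotations. -/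
lemma comp_rotPoint_mem {n ℓ : ℕ} {u : Sph n → ℂ} (hu : u ∈ sphericalHarmonics n ℓ) (R : SO n) :
    (fun x => u (rotPoint R x)) ∈ sphericalHarmonics n ℓ := by
  obtain ⟨p, ⟨hp, hΔ⟩, rfl⟩ := hu
  refine ⟨linSubst R.1 p, ⟨(MvPolynomial.mem_homogeneousSubmodule _ _).2 ?_,
    LinearMap.mem_ker.2 ?_⟩, ?_⟩
  · have := ((MvPolynomial.mem_homogeneousSubmodule _ _).1 hp).aeval
      (fun i => ∑ j, MvPolynomial.C ((R.1 i j : ℝ) : ℂ) * MvPolynomial.X j) (n := 1) fun i =>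
        MvPolynomial.IsHomogeneous.sum _ _ _ fun j _ => by
          simpa using (MvPolynomial.isHomogeneous_C (Fin n) ((R.1 i j : ℝ) : ℂ)).mul
            (MvPolynomial.isHomogeneous_X ℂ j)
    rwa [one_mul] at this
  · rw [polyLaplacian_linSubst (SO_mul_transpose R), LinearMap.mem_ker.1 hΔ, map_zero]
  · funext x
    exact eval_linSubst R.1 p x.1.ofLp

/-! ### Integration on the sphere -/

/-- The normalized surface measure. -/
def sphereMeasure (n : ℕ) : Measure (Sph n) :=
  ((volume : Measure (EuclideanSpace ℝ (Fin n))).toSphere Set.univ)⁻¹ •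
    (volume : Measure (EuclideanSpace ℝ (Fin n))).toSphere

instance instIsProbabilityMeasureSphereMeasure (n : ℕ) [NeZero n] :
    IsProbabilityMeasure (sphereMeasure n) := by
  have : NeZero (volume : Measure (EuclideanSpace ℝ (Fin n))).toSphere :=
    ⟨fun h => by
      have := (Measure.toSphere_eq_zero_iff_finrank _).1 h
      rw [finrank_euclideanSpace_fin] at this
      exact NeZero.ne n this⟩
  exact isProbabilityMeasureSMul

instance instIsOpenPosMeasureSphereMeasure (n : ℕ) : (sphereMeasure n).IsOpenPosMeasure :=
  Measure.isOpenPosMeasure_smul _ (ENNReal.inv_ne_zero.2 (measure_ne_top _ _))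

lemma sphereNormSq_eq {n : ℕ} (f : Sph n → ℂ) :
    sphereNormSq f = ∫ x, ‖f x‖ ^ 2 ∂sphereMeasure n := rfl

lemma measurePreserving_rotPoint_sphereMeasure {n : ℕ} (R : SO n) :
    MeasurePreserving (rotPoint R) (sphereMeasure n) (sphereMeasure n) :=
  (measurePreserving_rotPoint R).smul_measure _

/-- A rotation as a homeomorphism of the sphere. -/
def rotHomeomorph {n : ℕ} (R : SO n) : Sph n ≃ₜ Sph n where
  toFun := rotPoint R
  invFun := rotPoint R⁻¹
  left_inv := rotPoint_inv_rotPoint R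
  right_inv := rotPoint_rotPoint_inv R
  continuous_toFun := continuous_rotPoint.comp (Continuous.prodMk_right R)
  continuous_invFun := continuous_rotPoint.comp (Continuous.prodMk_right R⁻¹)

lemma integral_comp_rotPoint {n : ℕ} {E : Type*} [NormedAddCommGroup E] [NormedSpace ℝ E]
    (R : SO n) (g : Sph n → E) :
    ∫ x, g (rotPoint R x) ∂sphereMeasure n = ∫ x, g x ∂sphereMeasure n :=
  (measurePreserving_rotPoint_sphereMeasure R).integral_comp
    (rotHomeomorph R).measurableEmbedding g

lemma sphereNormSq_rotFun {n : ℕ} (R : SO n) (f : Sph n → ℂ) :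
    sphereNormSq (rotFun R f) = sphereNormSq f := by
  rw [sphereNormSq_eq, sphereNormSq_eq]
  exact integral_comp_rotPoint R⁻¹ fun x => ‖f x‖ ^ 2

lemma integrable_of_continuous {X E : Type*} [TopologicalSpace X] [CompactSpace X]
    [MeasurableSpace X] [OpensMeasurableSpace X] [NormedAddCommGroup E] {μ : Measure X}
    [IsFiniteMeasure μ] {g : X → E} (hg : Continuous g) : Integrable g μ :=
  hg.integrable_of_hasCompactSupport (HasCompactSupport.of_compactSpace g)

/-- The inner product `𝔼_x conj (u x) * v x`. -/
def sphereInner {n : ℕ} (u v : Sph n → ℂ) : ℂ :=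
  ∫ x, (starRingEnd ℂ) (u x) * v x ∂sphereMeasure n

lemma conj_sphereInner {n : ℕ} (u v : Sph n → ℂ) :
    (starRingEnd ℂ) (sphereInner u v) = sphereInner v u := by
  rw [sphereInner, sphereInner, ← integral_conj]
  refine integral_congr_ae (Filter.Eventually.of_forall fun x => ?_)
  simp [mul_comm]

lemma sphereInner_self {n : ℕ} (u : Sph n → ℂ) : sphereInner u u = (sphereNormSq u : ℂ) := by
  rw [sphereInner, sphereNormSq_eq, ← integral_complex_ofReal]
  refine integral_congr_ae (Filter.Eventually.of_forall fun x => ?_)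
  simp [Complex.conj_mul']

lemma sphereInner_comp_rotPoint {n : ℕ} (R : SO n) (u v : Sph n → ℂ) :
    sphereInner (fun x => u (rotPoint R x)) v = sphereInner u fun x => v (rotPoint R⁻¹ x) := by
  rw [sphereInner, sphereInner,
    ← integral_comp_rotPoint R fun x => (starRingEnd ℂ) (u x) * v (rotPoint R⁻¹ x)]
  simp

/-- A continuous function that vanishes almost everywhere vanishes everywhere, since the surface
measure charges every nonempty open set. This is the definiteness of the inner product on harmonics.
-/
lemma eq_zero_of_sphereNormSq_eq_zero {n : ℕ} [NeZero n] {u : Sph n → ℂ} (hu : Continuous u)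
    (h : sphereNormSq u = 0) : u = 0 := by
  have hc : Continuous fun x => ‖u x‖ ^ 2 := hu.norm.pow 2
  rw [sphereNormSq_eq, integral_eq_zero_iff_of_nonneg (fun x => by positivity)
    (integrable_of_continuous hc)] at h
  have := (hc.ae_eq_iff_eq (sphereMeasure n) continuous_const).1 h
  funext x
  have h0 : ‖u x‖ ^ 2 = 0 := congrFun this x
  simpa using h0

/-- An orthonormal basis of the space of spherical harmonics. -/
lemma exists_orthonormal_basis (n ℓ : ℕ) [NeZero n] :
    ∃ b : Fin (harmDim n ℓ) → Sph n → ℂ, (∀ i, b i ∈ sphericalHarmonics n ℓ) ∧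
      (∀ i, sphereInner (b i) (b i) = 1) ∧
      ∀ u ∈ sphericalHarmonics n ℓ, ∀ x, u x = ∑ i, sphereInner (b i) u * b i x := by
  let V := sphericalHarmonics n ℓ
  have hc : ∀ u : V, Continuous u.1 := fun u => continuous_of_mem_sphericalHarmonics u.2
  let core : InnerProductSpace.Core ℂ V :=
    { inner := fun u v => sphereInner u.1 v.1
      conj_inner_symm := fun u v => conj_sphereInner _ _
      re_inner_nonneg := fun u => by
        rw [sphereInner_self, sphereNormSq_eq]
        exact integral_nonneg fun x => by positivity
      add_left := fun u v w => by
        rw [sphereInner, sphereInner, sphereInner, ← integral_add]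
        · refine integral_congr_ae (Filter.Eventually.of_forall fun x => ?_)
          simp [add_mul]
        · exact integrable_of_continuous
            ((Complex.continuous_conj.comp (hc u)).mul (hc w))
        · exact integrable_of_continuous
            ((Complex.continuous_conj.comp (hc v)).mul (hc w))
      smul_left := fun u v r => by
        rw [sphereInner, sphereInner, ← integral_const_mul]
        refine integral_congr_ae (Filter.Eventually.of_forall fun x => ?_)
        simp [mul_assoc]
      definite := fun u h => by
        rw [sphereInner_self, Complex.ofReal_eq_zero] at h
        exact Subtype.ext (eq_zero_of_sphereNormSq_eq_zero (hc u) h) }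
  let : NormedAddCommGroup V := core.toNormedAddCommGroup
  let : InnerProductSpace ℂ V := InnerProductSpace.ofCore core.toCore
  let e := stdOrthonormalBasis ℂ V
  refine ⟨fun i => (e i).1, fun i => (e i).2, fun i => ?_, fun u hu x => ?_⟩
  · exact (orthonormal_iff_ite.1 e.orthonormal i i).trans (if_pos rfl)
  · have h := congrArg (fun v : V => v.1 x) (e.sum_repr' ⟨u, hu⟩)
    simp only [Submodule.coe_sum, Finset.sum_apply, Submodule.coe_smul, Pi.smul_apply,
      smul_eq_mul] at h
    exact h.symm

/-! ### Invariant kernels -/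

/-- A rotation-invariant kernel made of spherical harmonics is a multiple of the Gegenbauer
kernel. -/
lemma exists_eq_gegenbauerG_of_invariant {n : ℕ} [NeZero n] (hn : 3 ≤ n) {ℓ : ℕ}
    {k : Sph n → Sph n → ℂ} (hk : ∀ y, (fun x => k x y) ∈ sphericalHarmonics n ℓ)
    (hinv : ∀ (R : SO n) x y, k (rotPoint R x) (rotPoint R y) = k x y) :
    ∃ c : ℂ, ∀ x y, k x y = c * gegenbauerG n ℓ (inner ℝ x.1 y.1) := by
  obtain ⟨c, hc⟩ := exists_eq_gegenbauerG_of_zonal hn (hk (northPole n)) fun S hS x => by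
    have := hinv S x (northPole n)
    rwa [hS] at this
  refine ⟨c, fun x y => ?_⟩
  obtain ⟨R, hR⟩ := exists_rotPoint_eq hn y (northPole n)
  rw [← hinv R, hR, hc, ← hR, inner_rotPoint, real_inner_comm]

lemma inner_self_sphere {n : ℕ} (x : Sph n) : inner ℝ x.1 x.1 = (1 : ℝ) := by
  rw [inner_eq_dotProduct, dotProduct_self_sphere]

/-- The normalization of the Gegenbauer polynomials in terms of the dimension of the space of
spherical harmonics. -/
theorem gegenbauerN_mul_harmDim {n : ℕ} [NeZero n] (hn : 3 ≤ n) {ℓ : ℕ} (hd : harmDim n ℓ ≠ 0) :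
    gegenbauerN n ℓ = gegenbauerG n ℓ 1 ^ 2 / harmDim n ℓ := by
  obtain ⟨b, hb, hb1, hexp⟩ := exists_orthonormal_basis n ℓ
  have hbc : ∀ i, Continuous (b i) := fun i => continuous_of_mem_sphericalHarmonics (hb i)
  -- `Z` is the reproducing kernel of the space. Its reproducing property `hrep` characterizes it
  -- without reference to the basis, which is why it is rotation invariant.
  let Z : Sph n → Sph n → ℂ := fun x y => ∑ i, (starRingEnd ℂ) (b i y) * b i x
  have hZ : ∀ y, (fun x => Z x y) ∈ sphericalHarmonics n ℓ := by
    intro y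
    have : (fun x => Z x y) = ∑ i, (starRingEnd ℂ) (b i y) • b i := by
      funext x
      simp [Z]
    rw [this]
    exact Submodule.sum_mem _ fun i _ => Submodule.smul_mem _ _ (hb i)
  have hrep : ∀ y, ∀ u ∈ sphericalHarmonics n ℓ, sphereInner (fun x => Z x y) u = u y := by
    intro y u hu
    have hint : ∀ i, Integrable (fun x => (starRingEnd ℂ) (b i x) * u x) (sphereMeasure n) :=
      fun i => integrable_of_continuous ((Complex.continuous_conj.comp (hbc i)).mul
        (continuous_of_mem_sphericalHarmonics hu))
    rw [hexp u hu y]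
    simp only [sphereInner, Z, map_sum, map_mul, Complex.conj_conj, Finset.sum_mul]
    rw [integral_finsetSum]
    · refine Finset.sum_congr rfl fun i _ => ?_
      rw [← integral_mul_const]
      exact integral_congr_ae (Filter.Eventually.of_forall fun x => by ring)
    · intro i _
      simpa only [mul_assoc] using (hint i).const_mul (b i y)
  have hinv : ∀ (R : SO n) x y, Z (rotPoint R x) (rotPoint R y) = Z x y := by
    intro R x y
    rw [hexp _ (comp_rotPoint_mem (hZ (rotPoint R y)) R) x]
    refine Finset.sum_congr rfl fun i _ => ?_
    rw [← conj_sphereInner, sphereInner_comp_rotPoint R (fun x => Z x (rotPoint R y)),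
      hrep _ _ (comp_rotPoint_mem (hb i) R⁻¹), rotPoint_inv_rotPoint]
  obtain ⟨c, hc⟩ := exists_eq_gegenbauerG_of_invariant hn hZ hinv
  -- Integrating `Z` over the diagonal counts the basis vectors.
  have htrace : c * gegenbauerG n ℓ 1 = harmDim n ℓ := by
    have h1 : ∫ x, Z x x ∂sphereMeasure n = harmDim n ℓ := by
      simp only [Z]
      rw [integral_finsetSum]
      · change ∑ i, sphereInner (b i) (b i) = _
        simp [hb1]
      · exact fun i _ => integrable_of_continuous
          ((Complex.continuous_conj.comp (hbc i)).mul (hbc i))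
    simp only [hc, inner_self_sphere] at h1
    simpa using h1
  have hG := gegenbauerG_one_pos hn ℓ
  -- Reproducing the function Z(·, η) at η gives ‖Z(·, η)‖² = Z(η, η) = d_ℓ; on the other hand this
  -- norm is |c|² N_ℓ.
  have hnorm : sphereNormSq (fun x => Z x (northPole n)) = harmDim n ℓ := by
    have h1 := hrep (northPole n) _ (hZ (northPole n))
    rw [sphereInner_self, hc, inner_self_sphere, htrace] at h1
    exact_mod_cast h1
  have hnorm' : sphereNormSq (fun x => Z x (northPole n)) = ‖c‖ ^ 2 * gegenbauerN n ℓ := by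
    rw [gegenbauerN, sphereNormSq_eq, sphereNormSq_eq, ← integral_const_mul]
    refine integral_congr_ae (Filter.Eventually.of_forall fun x => ?_)
    simp only [hc, norm_mul, mul_pow, real_inner_comm]
  have hcn : ‖c‖ * gegenbauerG n ℓ 1 = harmDim n ℓ := by
    have := congrArg norm htrace
    rwa [norm_mul, Complex.norm_real, Real.norm_of_nonneg hG.le, Complex.norm_natCast] at this
  have hd' : (harmDim n ℓ : ℝ) ≠ 0 := Nat.cast_ne_zero.2 hd
  have hc0 : ‖c‖ ≠ 0 := fun h => hd' (by rw [← hcn, h, zero_mul])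
  rw [eq_div_iff hd']
  refine mul_left_cancel₀ (pow_ne_zero 2 hc0) ?_
  rw [← mul_assoc, ← hnorm', hnorm, ← mul_pow, hcn, pow_two]

/-! ### Averaging over rotations -/

instance instSecondCountableTopologySO (n : ℕ) : SecondCountableTopology (SO n) := by
  have : SecondCountableTopology (Matrix (Fin n) (Fin n) ℝ) :=
    inferInstanceAs (SecondCountableTopology (Fin n → Fin n → ℝ))
  exact inferInstanceAs (SecondCountableTopology
    ((Matrix.specialOrthogonalGroup (Fin n) ℝ : Set (Matrix (Fin n) (Fin n) ℝ))))

lemma continuous_rotFun {n : ℕ} {f : Sph n → ℂ} (hf : Continuous f) :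
    Continuous fun p : SO n × Sph n => rotFun p.1 f p.2 :=
  hf.comp (continuous_rotPoint.comp ((continuous_inv.comp continuous_fst).prodMk continuous_snd))

lemma continuous_rotFun_apply {n : ℕ} {f : Sph n → ℂ} (hf : Continuous f) (x : Sph n) :
    Continuous fun R : SO n => rotFun R f x :=
  (continuous_rotFun hf).comp (Continuous.prodMk_left x)

/-- The two-point correlation of a randomly rotated function. -/
def rotKernel {n : ℕ} (f : Sph n → ℂ) (x y : Sph n) : ℂ :=
  ∫ R : SO n, rotFun R f x * (starRingEnd ℂ) (rotFun R f y) ∂haarSO n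

/-- Substitute R ↦ SR, under which Haar measure is invariant: (SR)⁻¹ S x = R⁻¹ x. -/
lemma rotKernel_rotPoint {n : ℕ} (f : Sph n → ℂ) (S : SO n) (x y : Sph n) :
    rotKernel f (rotPoint S x) (rotPoint S y) = rotKernel f x y := by
  rw [rotKernel, ← integral_mul_left_eq_self _ S]
  simp only [rotFun, mul_inv_rev, rotPoint_mul, rotPoint_inv_rotPoint]
  rfl

/-- Expanding `Rf` in a fixed finite basis puts the whole dependence on `R` into the coefficients,
so the average stays in the space. -/
lemma rotKernel_mem {n ℓ : ℕ} [NeZero n] {f : Sph n → ℂ} (hf : f ∈ sphericalHarmonics n ℓ)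
    (y : Sph n) : (fun x => rotKernel f x y) ∈ sphericalHarmonics n ℓ := by
  obtain ⟨b, hb, -, hexp⟩ := exists_orthonormal_basis n ℓ
  have hfc := continuous_of_mem_sphericalHarmonics hf
  have hcont : ∀ i, Continuous fun R : SO n => sphereInner (b i) (rotFun R f) := by
    intro i
    have h : Continuous (Function.uncurry fun (R : SO n) (x : Sph n) =>
        (starRingEnd ℂ) (b i x) * rotFun R f x) :=
      (Complex.continuous_conj.comp ((continuous_of_mem_sphericalHarmonics (hb i)).comp
        continuous_snd)).mul (continuous_rotFun hfc)
    simpa [sphereInner] using continuous_parametric_integral_of_continuous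
      (μ := sphereMeasure n) h isCompact_univ
  have : (fun x => rotKernel f x y) = ∑ i, (∫ R : SO n, sphereInner (b i) (rotFun R f) *
      (starRingEnd ℂ) (rotFun R f y) ∂haarSO n) • b i := by
    funext x
    rw [rotKernel]
    simp only [Finset.sum_apply, Pi.smul_apply, smul_eq_mul]
    simp only [← integral_mul_const]
    rw [← integral_finsetSum]
    · refine integral_congr_ae (Filter.Eventually.of_forall fun R => ?_)
      have hR : rotFun R f ∈ sphericalHarmonics n ℓ := comp_rotPoint_mem hf R⁻¹
      beta_reduce
      rw [hexp _ hR x, Finset.sum_mul]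
      exact Finset.sum_congr rfl fun i _ => by ring
    · exact fun i _ => (integrable_of_continuous ((hcont i).mul
        (Complex.continuous_conj.comp (continuous_rotFun_apply hfc y)))).mul_const _
  rw [this]
  exact Submodule.sum_mem _ fun i _ => Submodule.smul_mem _ _ (hb i)

/-- By Fubini, this is the average over R of ‖Rf‖², which is constant in R. It determines the scalar
in `rotKernel_eq`. -/
lemma integral_rotKernel_self {n : ℕ} [NeZero n] {f : Sph n → ℂ} (hf : Continuous f) :
    ∫ x, rotKernel f x x ∂sphereMeasure n = sphereNormSq f := by
  simp only [rotKernel]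
  rw [integral_integral_swap_of_hasCompactSupport _ (HasCompactSupport.of_compactSpace _)]
  · have h : ∀ R : SO n, ∫ x, rotFun R f x * (starRingEnd ℂ) (rotFun R f x) ∂sphereMeasure n =
        sphereNormSq f := by
      intro R
      rw [← sphereNormSq_rotFun R, ← sphereInner_self, sphereInner]
      exact integral_congr_ae (Filter.Eventually.of_forall fun x => mul_comm _ _)
    simp [h]
  · have h := (continuous_rotFun hf).comp (continuous_swap (X := Sph n) (Y := SO n))
    exact h.mul (Complex.continuous_conj.comp h)

/-- The correlation of a randomly rotated spherical harmonic. -/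
theorem rotKernel_eq {n ℓ : ℕ} [NeZero n] (hn : 3 ≤ n) {f : Sph n → ℂ}
    (hf : f ∈ sphericalHarmonics n ℓ) (x y : Sph n) :
    rotKernel f x y = ((sphereNormSq f / gegenbauerG n ℓ 1 *
      gegenbauerG n ℓ (inner ℝ x.1 y.1) : ℝ) : ℂ) := by
  obtain ⟨c, hc⟩ := exists_eq_gegenbauerG_of_invariant hn (rotKernel_mem hf) (rotKernel_rotPoint f)
  have h := integral_rotKernel_self (continuous_of_mem_sphericalHarmonics hf)
  simp only [hc, inner_self_sphere, integral_const, probReal_univ, one_smul] at h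
  have hG : (gegenbauerG n ℓ 1 : ℂ) ≠ 0 := by exact_mod_cast (gegenbauerG_one_pos hn ℓ).ne'
  rw [hc]
  push_cast
  rw [← h, mul_div_cancel_right₀ _ hG]

/-! ### Kravchuk polynomials -/

/-- The character `χ_k` of `ℤ₂ⁿ`, with real values. -/
def signChar {n : ℕ} (k z : Fin n → ZMod 2) : ℝ :=
  ∏ i, if k i = 1 then (-1) ^ (z i).val else 1

lemma zmod_two_eq_zero_or_one (a : ZMod 2) : a = 0 ∨ a = 1 := by
  revert a
  decide

/-- The difference is used, rather than the equal sum in ℤ₂ⁿ, to match the Hamming distance in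
`inner_cubePoint`. -/
lemma signChar_mul {n : ℕ} (k z w : Fin n → ZMod 2) :
    signChar k z * signChar k w = signChar k (z - w) := by
  rw [signChar, signChar, signChar, ← Finset.prod_mul_distrib]
  refine Finset.prod_congr rfl fun i _ => ?_
  rw [Pi.sub_apply]
  have h : ∀ a b : ZMod 2, (-1 : ℝ) ^ a.val * (-1) ^ b.val = (-1) ^ (a - b).val := by
    intro a b
    have h2 : (0 - 1 : ZMod 2) = 1 := by decide
    rcases zmod_two_eq_zero_or_one a with rfl | rfl <;> rcases zmod_two_eq_zero_or_one b with rfl | rfl <;>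
      simp [ZMod.val_one, h2]
  split_ifs
  · exact h _ _
  · simp

lemma character_cubePoint {n : ℕ} [NeZero n] (k z : Fin n → ZMod 2) :
    character k (cubePoint z) = (signChar k z : ℂ) := by
  have hn : Real.sqrt n ≠ 0 := Real.sqrt_ne_zero'.2 (Nat.cast_pos.2 (NeZero.pos n))
  rw [character, signChar, Finset.prod_filter]
  push_cast
  refine Finset.prod_congr rfl fun i _ => ?_
  split_ifs
  · rw [cubePoint, ← Complex.ofReal_mul]
    simp [mul_div_cancel₀, hn]
  · rfl

lemma inner_cubePoint {n : ℕ} [NeZero n] (z w : Fin n → ZMod 2) :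
    inner ℝ (cubePoint z).1 (cubePoint w).1 = 1 - 2 * (hammingNorm (z - w) : ℝ) / n := by
  have hn : (n : ℝ) ≠ 0 := Nat.cast_ne_zero.2 (NeZero.ne n)
  have h : ∀ i, (-1 : ℝ) ^ (z i).val / Real.sqrt n * ((-1) ^ (w i).val / Real.sqrt n) =
      (1 - 2 * if (z - w) i ≠ 0 then 1 else 0) / n := by
    intro i
    have h2 : ((0 : ZMod 2) - 1 ≠ 0) := by decide
    rw [div_mul_div_comm, Real.mul_self_sqrt (Nat.cast_nonneg n), Pi.sub_apply]
    congr 1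
    rcases zmod_two_eq_zero_or_one (z i) with hz | hz <;> rcases zmod_two_eq_zero_or_one (w i) with hw | hw <;>
      rw [hz, hw] <;> simp [ZMod.val_one, -zero_sub, h2] <;> norm_num
  rw [inner_eq_dotProduct, dotProduct, cubePoint, cubePoint]
  simp only [h]
  rw [← Finset.sum_div, Finset.sum_sub_distrib, ← Finset.mul_sum, Finset.sum_boole,
    hammingNorm]
  simp only [Finset.sum_const, Finset.card_univ, Fintype.card_fin, nsmul_eq_mul, mul_one]
  field_simp

lemma hammingNorm_eq_card_one {n : ℕ} (k : Fin n → ZMod 2) :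
    hammingNorm k = (Finset.univ.filter fun i => k i = 1).card := by
  rw [hammingNorm]
  congr 1
  refine Finset.filter_congr fun i _ => ?_
  rcases zmod_two_eq_zero_or_one (k i) with h | h <;> simp [h]

lemma coeff_one_sub_X_pow (m i : ℕ) :
    ((1 - Polynomial.X : Polynomial ℝ) ^ m).coeff i = (-1) ^ i * m.choose i := by
  have h : (1 - Polynomial.X : Polynomial ℝ) ^ m =
      ((1 + Polynomial.X) ^ m : Polynomial ℝ).comp (Polynomial.C (-1) * Polynomial.X) := by
    simp [sub_eq_add_neg]
  rw [h, Polynomial.comp_C_mul_X_coeff, Polynomial.coeff_one_add_X_pow, mul_comm]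

/-- The generating function of the Kravchuk polynomials: the defining sum is a convolution of
binomial coefficients. -/
lemma kravchuk_eq_coeff (n m h : ℕ) : (kravchuk n m h : ℝ) =
    (((1 - Polynomial.X) ^ m * (1 + Polynomial.X) ^ (n - m) : Polynomial ℝ)).coeff h := by
  rw [Polynomial.coeff_mul, Finset.Nat.sum_antidiagonal_eq_sum_range_succ_mk, kravchuk,
    ← Finset.sum_filter]
  simp only [coeff_one_sub_X_pow, Polynomial.coeff_one_add_X_pow]
  push_cast
  -- The convolution runs over all j ≤ h; the terms with j > m vanish with the binomial coefficient.
  refine Finset.sum_subset (fun j hj => ?_) fun j hj hj' => ?_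
  · have := (Finset.mem_filter.1 hj).2
    exact Finset.mem_range.2 (by omega)
  · have h1 := Finset.mem_range.1 hj
    have : m < j := by
      by_contra h2
      exact hj' (Finset.mem_filter.2 ⟨Finset.mem_range.2 (by omega), by omega⟩)
    simp [Nat.choose_eq_zero_of_lt this]

/-- The Kravchuk polynomial is a sum of the values of a character on a Hamming sphere. -/
lemma sum_signChar_hammingNorm_eq {n : ℕ} (k : Fin n → ZMod 2) (h : ℕ) :
    ∑ z with hammingNorm z = h, signChar k z = kravchuk n (hammingNorm k) h := by
  -- The generating function ∑_z χ_k(z) X^|z| factors over coordinates, with factor 1 - X where kᵢ =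
  -- 1 and 1 + X elsewhere.
  let g : Fin n → ZMod 2 → Polynomial ℝ := fun i a =>
    if a = 0 then 1 else if k i = 1 then -Polynomial.X else Polynomial.X
  have hg : ∀ z : Fin n → ZMod 2,
      ∏ i, g i (z i) = Polynomial.C (signChar k z) * Polynomial.X ^ hammingNorm z := by
    intro z
    rw [hammingNorm, Finset.card_filter, ← Finset.prod_pow_eq_pow_sum, signChar, map_prod,
      ← Finset.prod_mul_distrib]
    refine Finset.prod_congr rfl fun i _ => ?_
    rcases zmod_two_eq_zero_or_one (z i) with hz | hz
    · simp [g, hz]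
    · simp only [g, hz, ZMod.val_one]
      split_ifs <;> simp_all
  have hprod : ∏ i, ∑ a, g i a =
      (1 - Polynomial.X) ^ hammingNorm k * (1 + Polynomial.X) ^ (n - hammingNorm k) := by
    have hs : ∀ i, ∑ a, g i a = if k i = 1 then 1 - Polynomial.X else 1 + Polynomial.X := by
      intro i
      have : ∑ a, g i a = g i 0 + g i 1 := Fin.sum_univ_two (g i)
      rw [this]
      simp only [g, if_true, one_ne_zero, if_false]
      split_ifs <;> ring
    have hcard : (Finset.univ.filter fun i => ¬ k i = 1).card = n - hammingNorm k := by
      have := Finset.card_filter_add_card_filter_not (s := Finset.univ) (fun i => k i = 1)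
      rw [← hammingNorm_eq_card_one, Finset.card_univ, Fintype.card_fin] at this
      omega
    simp only [hs]
    rw [Finset.prod_ite, Finset.prod_const, Finset.prod_const, ← hammingNorm_eq_card_one, hcard]
  rw [Finset.prod_univ_sum, Fintype.piFinset_univ] at hprod
  rw [kravchuk_eq_coeff, ← hprod, Polynomial.finsetSum_coeff]
  simp only [hg, Polynomial.coeff_C_mul_X_pow]
  rw [Finset.sum_filter]
  exact Finset.sum_congr rfl fun z _ => by simp only [eq_comm]

lemma sum_signChar_mul {n : ℕ} (k : Fin n → ZMod 2) (F : ℕ → ℝ) :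
    ∑ z, signChar k z * F (hammingNorm z) =
      ∑ h ∈ Finset.range (n + 1), (kravchuk n (hammingNorm k) h : ℝ) * F h := by
  rw [← Finset.sum_fiberwise_of_maps_to (s := Finset.univ) (t := Finset.range (n + 1))
    (g := fun z : Fin n → ZMod 2 => hammingNorm z)]
  · refine Finset.sum_congr rfl fun h _ => ?_
    rw [← sum_signChar_hammingNorm_eq, Finset.sum_mul]
    exact Finset.sum_congr rfl fun z hz => by rw [(Finset.mem_filter.1 hz).2]
  · intro z _
    have := hammingNorm_le_card_fintype (x := z)
    rw [Fintype.card_fin] at this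
    exact Finset.mem_range.2 (by omega)

/-! ### The expected energy -/

lemma ofReal_energy {n : ℕ} [NeZero n] (f : Sph n → ℂ) (k : Fin n → ZMod 2) :
    (energy f k : ℂ) = ∑ z, ∑ w, ((signChar k (z - w) / 2 ^ n / 2 ^ n : ℝ) : ℂ) *
      (f (cubePoint z) * (starRingEnd ℂ) (f (cubePoint w))) := by
  rw [energy, Complex.ofReal_pow, ← Complex.conj_mul', cubeCoeff, cubeInner, map_mul, map_sum,
    mul_mul_mul_comm, Finset.sum_mul_sum, Finset.mul_sum]
  refine Finset.sum_congr rfl fun z _ => ?_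
  rw [Finset.mul_sum]
  refine Finset.sum_congr rfl fun w _ => ?_
  rw [← signChar_mul, character_cubePoint, character_cubePoint]
  have h2 : (starRingEnd ℂ) 2 = 2 := map_ofNat _ 2
  simp [h2]
  ring

lemma integrable_energy {n : ℕ} [NeZero n] {f : Sph n → ℂ} (hf : Continuous f)
    (k : Fin n → ZMod 2) : Integrable (fun R : SO n => energy (rotFun R f) k) (haarSO n) := by
  refine integrable_of_continuous ((Continuous.norm ?_).pow 2)
  exact continuous_const.mul (continuous_finsetSum _ fun z _ =>
    (Complex.continuous_conj.comp (continuous_rotFun_apply hf _)).mul continuous_const)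

/-- The expectation passes through the finite double sum and produces `rotKernel` at pairs of cube
points. -/
lemma integral_energy {n ℓ : ℕ} [NeZero n] (hn : 3 ≤ n) {f : Sph n → ℂ}
    (hf : f ∈ sphericalHarmonics n ℓ) (k : Fin n → ZMod 2) :
    ∫ R : SO n, energy (rotFun R f) k ∂haarSO n =
      sphereNormSq f / gegenbauerG n ℓ 1 * (1 / 2 ^ n) * ∑ h ∈ Finset.range (n + 1),
        (kravchuk n (hammingNorm k) h : ℝ) * gegenbauerG n ℓ (1 - 2 * (h : ℝ) / n) := by
  have hfc := continuous_of_mem_sphericalHarmonics hf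
  have h1 : ((∫ R : SO n, energy (rotFun R f) k ∂haarSO n : ℝ) : ℂ) =
      ∑ z, ∑ w, ((signChar k (z - w) / 2 ^ n / 2 ^ n : ℝ) : ℂ) *
        rotKernel f (cubePoint z) (cubePoint w) := by
    have hint : ∀ z w : Fin n → ZMod 2, Integrable (fun R : SO n =>
        ((signChar k (z - w) / 2 ^ n / 2 ^ n : ℝ) : ℂ) * (rotFun R f (cubePoint z) *
          (starRingEnd ℂ) (rotFun R f (cubePoint w)))) (haarSO n) := fun z w =>
      (integrable_of_continuous ((continuous_rotFun_apply hfc _).mul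
        (Complex.continuous_conj.comp (continuous_rotFun_apply hfc _)))).const_mul _
    rw [← integral_complex_ofReal]
    simp only [ofReal_energy]
    rw [integral_finsetSum _ fun z _ => integrable_finsetSum _ fun w _ => hint z w]
    refine Finset.sum_congr rfl fun z _ => ?_
    rw [integral_finsetSum _ fun w _ => hint z w]
    exact Finset.sum_congr rfl fun w _ => integral_const_mul _ _
  simp only [rotKernel_eq hn hf, inner_cubePoint, ← Complex.ofReal_mul, ← Complex.ofReal_sum] at h1
  rw [Complex.ofReal_injective h1, ← sum_signChar_mul k fun h =>
    gegenbauerG n ℓ (1 - 2 * (h : ℝ) / n), Finset.sum_comm]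
  -- The summand depends only on `z - w`, so translation makes the inner sum independent of `w`; the
  -- outer sum then cancels one factor 1 / 2ⁿ.
  have h2 : ∀ w : Fin n → ZMod 2, ∑ z, signChar k (z - w) / 2 ^ n / 2 ^ n *
      (sphereNormSq f / gegenbauerG n ℓ 1 *
        gegenbauerG n ℓ (1 - 2 * (hammingNorm (z - w) : ℝ) / n)) =
      sphereNormSq f / gegenbauerG n ℓ 1 * (1 / 2 ^ n) / 2 ^ n *
        ∑ z, signChar k z * gegenbauerG n ℓ (1 - 2 * (hammingNorm z : ℝ) / n) := by
    intro w
    rw [← Equiv.sum_comp (Equiv.subRight w) fun z =>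
      signChar k z * gegenbauerG n ℓ (1 - 2 * (hammingNorm z : ℝ) / n), Finset.mul_sum]
    refine Finset.sum_congr rfl fun z _ => ?_
    rw [Equiv.subRight_apply]
    ring
  simp only [h2, Finset.sum_const, Finset.card_univ, Fintype.card_fun, ZMod.card,
    Fintype.card_fin, nsmul_eq_mul]
  push_cast
  field_simp

end

end SphereCube

open SphereCube
theorem mainTheorem6 (n : ℕ) [NeZero n] (hn : 3 ≤ n) (ℓ : ℕ)
    (f : Sph n → ℂ) (hf : f ∈ sphericalHarmonics n ℓ) (k : Fin n → ZMod 2) :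
    Integrable (fun R : SO n => energy (rotFun R f) k) (haarSO n) ∧
    ∫ R : SO n, energy (rotFun R f) k ∂(haarSO n) =
      sphereNormSq f / Real.sqrt (harmDim n ℓ) * (1 / 2 ^ n) *
        ∑ h ∈ Finset.range (n + 1),
          (kravchuk n (hammingNorm k) h : ℝ) * gegenbauer n ℓ (1 - 2 * (h : ℝ) / n) := by
  refine ⟨integrable_energy (continuous_of_mem_sphericalHarmonics hf) k, ?_⟩
  rw [integral_energy hn hf]
  -- If the space were zero then f = 0 and both sides vanish; treating this case avoids having to
  -- exhibit a nonzero harmonic before dividing by the dimension.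
  by_cases hd : harmDim n ℓ = 0
  · have hbot : sphericalHarmonics n ℓ = ⊥ := Submodule.finrank_eq_zero.1 hd
    rw [hbot, Submodule.mem_bot] at hf
    have : sphereNormSq f = 0 := by simp [hf, sphereNormSq_eq]
    simp [this]
  · have hG := gegenbauerG_one_pos hn ℓ
    have hs : Real.sqrt (harmDim n ℓ) ≠ 0 :=
      Real.sqrt_ne_zero'.2 (Nat.cast_pos.2 (Nat.pos_of_ne_zero hd))
    have hN : Real.sqrt (gegenbauerN n ℓ) = gegenbauerG n ℓ 1 / Real.sqrt (harmDim n ℓ) := by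
      rw [gegenbauerN_mul_harmDim hn hd, Real.sqrt_div (sq_nonneg _), Real.sqrt_sq hG.le]
    simp only [gegenbauer, hN, Finset.mul_sum]
    refine Finset.sum_congr rfl fun h _ => ?_
    field_simp
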